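/- Let $m_*\ge 1$ be an integer, let $\varepsilon_*,\delta_*,C_*>0$, let $J$ be a finite index set, and for $j\in J$ let $a_j\in(0,1)$ and let $m_j\ge 1$ be an integer. Let $A\in C^{2m_*+1}([0,1])$ and $B\in C^2([0,1])$ be real-valued, and for $n\ge1$ let $A_n,B_n:\{0,\tfrac1n,\dots,1\}\to\mathbb R$. Let $X_n$ be a random variable with $$\mathbb P[X_n=k]=\frac1{Z_n}\exp\Bigl(nA_n(k/n)+n^{1/(2m_*)}B_n(k/n)\Bigr),\qquad 0\le k\le n,$$ where $Z_n$ is the normalizing constant. Assume: (A1) The $a_j$, $j\in J$, are all the maximizers of $A$ on $[0,1]$, and $\max_{j\in J}m_j=m_*$. For every $j\in J$, $A'(a_j)=\dots=A^{(2m_j-1)}(a_j)=0$ and $\max_{|x-a_j|\le\delta_*}A^{(2m_j)}(x)<0$. The intervals $(a_j-\delta_*,a_j+\delta_*)$, $j\in J$, are pairwise disjoint and contained in $(0,1)$. (A2) For all large enough $n$ and all $0\le k\le n$ with $|k/n-a_j|\ge\delta_*$ for every $j\in J$, $$A_n(k/n)\le\max_{[0,1]}A-\varepsilon_*\quad\text{and}\quad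 |B_n(k/n)|\le C_*.$$ (A3) For all large enough $n$ and all $0\le k,\ell\le n$ for which there is $j\in J$ with $|k/n-a_j|<\delta_*$ and $|\ell/n-a_j|<\delta_*$, $$|A_n(k/n)-A(k/n)|\le\frac{C_*\log n}{n},\qquad |B_n(k/n)-B(k/n)|\le\frac{C_*}{n},$$ $$\bigl|[A_n(k/n)-A_n(\ell/n)]-[A(k/n)-A(\ell/n)]\bigr|\le\frac{C_*|k-\ell|}{n^2}.$$ For $j\in J$ put $c_j=A^{(2m_j)}(a_j)/(2m_j)!$, and $b_j=B'(a_j)$ if $m_j=m_*$, $b_j=0$ otherwise. Let $Y_j$ be a random variable with density proportional to $x\mapsto\exp(c_jx^{2m_j}+b_jx)$ on $\mathbb R$. Let $d_{\mathrm W}(\mu,\nu)=\sup_h|\int h\,d\mu-\int h\,d\nu|$, with the supremum over all $1$-Lipschitz $h:\mathbb R\to\mathbb R$, be the Wasserstein distance. Then for every $j\in J$ the event $\{|X_n-na_j|\le n\delta_*\}$ has positive probability for all large enough $n$, and the following bounds hold for all $n\ge1$ for which it has positive probability, where the constants implied by $O(\cdot)$ do not depend on $n$. For every integer $l\ge0$,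 $$\mathbb E\bigl\{|X_n/n-a_j|^l\,\big|\,|X_n-na_j|\le n\delta_*\bigr\}=O\bigl(n^{-l/(2m_j)}\bigr),$$ and $$d_{\mathrm W}\Bigl(\mathcal L\bigl(n^{1/(2m_j)}(X_n/n-a_j)\,\big|\,|X_n-na_j|\le n\delta_*\bigr),\mathcal L(Y_j)\Bigr)=O\bigl(n^{-1/(2m_j)}\bigr)+O\bigl(n^{1/(2m_*)-1/(2m_j)}\,\mathbf 1[m_j\ne m_*]\bigr).$$ -/

import Mathlib

open MeasureTheory ProbabilityTheory Filter Set
open scoped ENNReal NNReal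

noncomputable section

namespace PerturbedModel

/-- The Wasserstein distance `sup {|∫ h dμ - ∫ h dν| : h is 1-Lipschitz}`, with values in `[0, ∞]`. -/
def wasserstein (μ ν : Measure ℝ) : ℝ≥0∞ :=
  ⨆ (h : ℝ → ℝ) (_ : LipschitzWith 1 h), ENNReal.ofReal |∫ x, h x ∂μ - ∫ x, h x ∂ν|

/-- The probability measure on `ℝ` with density proportional to `exp (c x ^ (2m) + b x)`. -/
def limitLaw (m : ℕ) (c b : ℝ) : Measure ℝ :=
  volume.withDensity fun x =>
    ENNReal.ofReal (Real.exp (c * x ^ (2 * m) + b * x) /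
      ∫ y, Real.exp (c * y ^ (2 * m) + b * y))

/-- The scale `σ = n ^ (-1 + 1 / (2m))`. -/
def sigma (m n : ℕ) : ℝ := (n : ℝ) ^ (-1 + 1 / (2 * (m : ℝ)))

/-- The Hamiltonian `H_n(x) = n A_n(x) + n σ B_n(x)`; it is only used at `x = k / n`, `0 ≤ k ≤ n`. -/
def hamiltonian (m : ℕ) (An Bn : ℕ → ℝ → ℝ) (n : ℕ) (x : ℝ) : ℝ :=
  n * An n x + n * sigma m n * Bn n x

/-- The partition function `Z_n`. -/
def partition (m : ℕ) (An Bn : ℕ → ℝ → ℝ) (n : ℕ) : ℝ :=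
  ∑ k ∈ Finset.range (n + 1), Real.exp (hamiltonian m An Bn n ((k : ℝ) / n))

/-- The random variable `X` has the law `P[X = k] = exp (H_n(k / n)) / Z_n`, `0 ≤ k ≤ n`. -/
def HasGibbsLaw {Ω : Type*} [MeasurableSpace Ω] (P : Measure Ω) (X : Ω → ℕ)
    (m : ℕ) (An Bn : ℕ → ℝ → ℝ) (n : ℕ) : Prop :=
  ∀ k : ℕ, k ≤ n → P {ω | X ω = k} =
    ENNReal.ofReal (Real.exp (hamiltonian m An Bn n ((k : ℝ) / n)) / partition m An Bn n)

/-- The points `a j` are all the maximizers of `A` on `[0, 1]`, `a j` is regular of order `2 (m j)`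
with maximal `m j` equal to `mStar`, and the `δ`-neighbourhoods are disjoint and lie in `(0, 1)`. -/
structure MaximizerCondition {J : Type*} (a : J → ℝ) (m : J → ℕ) (mStar : ℕ) (δ : ℝ)
    (A : ℝ → ℝ) : Prop where
  maximizers : ∀ x : ℝ, x ∈ range a ↔ x ∈ Icc (0 : ℝ) 1 ∧ IsMaxOn A (Icc 0 1) x
  isGreatest : IsGreatest (range m) mStar
  deriv_eq_zero : ∀ j, ∀ i : ℕ, 1 ≤ i → i < 2 * m j →
    iteratedDerivWithin i A (Icc 0 1) (a j) = 0
  deriv_neg : ∀ j, ∀ x : ℝ, |x - a j| ≤ δ →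
    iteratedDerivWithin (2 * m j) A (Icc 0 1) x < 0
  disjoint : ∀ i j, i ≠ j → Disjoint (Ioo (a i - δ) (a i + δ)) (Ioo (a j - δ) (a j + δ))
  subset : ∀ j, Ioo (a j - δ) (a j + δ) ⊆ Ioo 0 1

/-- Away from the maximizers, `A_n` is smaller than `max A` by `ε`, and `B_n` is bounded. -/
def FarCondition {J : Type*} (a : J → ℝ) (ε δ C : ℝ) (A : ℝ → ℝ) (An Bn : ℕ → ℝ → ℝ) : Prop :=
  ∀ᶠ n : ℕ in atTop, ∀ k : ℕ, k ≤ n → (∀ j, δ ≤ |(k : ℝ) / n - a j|) →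
    An n ((k : ℝ) / n) ≤ sSup (A '' Icc 0 1) - ε ∧ |Bn n ((k : ℝ) / n)| ≤ C

/-- Near the maximizers, `A_n`, `B_n` and the increments of `A_n` are close to those of `A`, `B`. -/
def NearCondition {J : Type*} (a : J → ℝ) (δ C : ℝ) (A B : ℝ → ℝ) (An Bn : ℕ → ℝ → ℝ) : Prop :=
  ∀ᶠ n : ℕ in atTop, ∀ k l : ℕ, k ≤ n → l ≤ n →
    (∃ j, |(k : ℝ) / n - a j| < δ ∧ |(l : ℝ) / n - a j| < δ) →
      |An n ((k : ℝ) / n) - A ((k : ℝ) / n)| ≤ C * Real.log n / n ∧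
      |Bn n ((k : ℝ) / n) - B ((k : ℝ) / n)| ≤ C / n ∧
      |(An n ((k : ℝ) / n) - An n ((l : ℝ) / n)) - (A ((k : ℝ) / n) - A ((l : ℝ) / n))|
        ≤ C * |(k : ℝ) - l| / (n : ℝ) ^ 2

/-- `c = A^(2m)(x) / (2m)!`. -/
def coeffC (A : ℝ → ℝ) (m : ℕ) (x : ℝ) : ℝ :=
  iteratedDerivWithin (2 * m) A (Icc 0 1) x / (Nat.factorial (2 * m) : ℝ)

/-- `b = B'(x)` if `m = mStar`, and `b = 0` otherwise. -/
def coeffB (B : ℝ → ℝ) (m mStar : ℕ) (x : ℝ) : ℝ :=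
  if m = mStar then derivWithin B (Icc 0 1) x else 0

/-- The event `|X - n x| ≤ n δ`. -/
def window {Ω : Type*} (X : Ω → ℕ) (n : ℕ) (x δ : ℝ) : Set Ω :=
  {ω | |(X ω : ℝ) - n * x| ≤ n * δ}

end PerturbedModel

end

namespace PerturbedModel

/-! The proof is Laplace's method with explicit errors. Fix `j`, write `s = n ^ (1/(2 m_j))`, `T = n
^ (1/(2 m_*))`, `y = s (k/n - a_j)`, and normalise the weights by the one at `k₀ = ⌊n a_j⌋`. The
exponent becomes `n (A_n(x) - A_n(x₀)) + T (B_n(x) - B_n(x₀))` with `x = k/n`, `x₀ = k₀/n`. Only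
increments of `A_n` enter, so in the open window the third bound of (A3) replaces `A_n` by `A` at
cost `O((1 + |y|)/s)`, and the error `log n / n` plays no role. Since `s ^ (2 m_j) = n`, Taylor's
formula gives `c y ^ (2 m_j) + O(|y| ^ (2 m_j + 1) / s)` for `A`. The term in `B` gives `b y + O(y ^
2 / s)` if `m_j = m_*` and is an error `O(|y| T / s)` otherwise. These two errors are the two terms
of the rate `r`.

The exponent is also at most `K - κ y ^ (2 m_j)`, so the polynomial factors are harmless and each
weight is within `O(r)` of the limiting density, with any power of `1 + |y|` to spare
(`exists_weight_bounds`, `exists_abs_exp_sub_tilt_le`). The grid in `y` has mesh `s/n ≤ 1/s ≤ r`, so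
normalised sums are Riemann sums of the limiting integrals up to `O(r)`, uniformly over 1-Lipschitz
test functions vanishing at `0` (`exists_abs_sum_sub_integral_le`). Dividing by the same estimate
for the constant `1` gives the Wasserstein bound; domination alone gives the moments. The finitely
many remaining `n` are absorbed into the constants. -/

/-! ### Taylor expansions of `A` and `B` at a maximizer -/

theorem iteratedDerivWithin_subset {f : ℝ → ℝ} {s t : Set ℝ} {n : ℕ} (hst : s ⊆ t)
    (hs : UniqueDiffOn ℝ s) (ht : UniqueDiffOn ℝ t) (hf : ContDiffOn ℝ n f t) {x : ℝ}
    (hx : x ∈ s) : iteratedDerivWithin n f s x = iteratedDerivWithin n f t x := by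
  simp only [iteratedDerivWithin, iteratedFDerivWithin_subset hst hs ht hf hx]

/-- Lagrange's form of Taylor's theorem at a point where the first `k` derivatives vanish. -/
theorem exists_sub_eq_iteratedDerivWithin_mul_pow {f : ℝ → ℝ} {k : ℕ} {a x : ℝ}
    (hf : ContDiffOn ℝ (k + 1 : ℕ) f (Icc 0 1)) (ha : a ∈ Icc (0 : ℝ) 1) (hx : x ∈ Icc (0 : ℝ) 1)
    (h0 : ∀ i : ℕ, 1 ≤ i → i < k + 1 → iteratedDerivWithin i f (Icc 0 1) a = 0) :
    ∃ y, |y - a| ≤ |x - a| ∧ y ∈ Icc (0 : ℝ) 1 ∧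
      f x - f a = iteratedDerivWithin (k + 1) f (Icc 0 1) y * (x - a) ^ (k + 1) /
        (Nat.factorial (k + 1) : ℝ) := by
  rcases eq_or_ne a x with rfl | hne
  · exact ⟨a, by simp, ha, by simp⟩
  have hsub : uIcc a x ⊆ Icc 0 1 := uIcc_subset_Icc ha hx
  have hu : UniqueDiffOn ℝ (uIcc a x) := uniqueDiffOn_uIcc hne
  have hI : UniqueDiffOn ℝ (Icc (0 : ℝ) 1) := uniqueDiffOn_Icc one_pos
  have hk : ContDiffOn ℝ k f (uIcc a x) := (hf.mono hsub).of_le (by norm_cast; omega)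
  have hd : DifferentiableOn ℝ (iteratedDerivWithin k f (uIcc a x)) (uIcc a x) :=
    (hf.mono hsub).differentiableOn_iteratedDerivWithin (by norm_cast; omega) hu
  obtain ⟨y, hy, h⟩ := taylor_mean_remainder_lagrange hne hk
    (hd.mono fun _ h => ⟨h.1.le, h.2.le⟩)
  have hy' : y ∈ uIcc a x := ⟨hy.1.le, hy.2.le⟩
  refine ⟨y, ?_, hsub hy', ?_⟩
  · exact abs_sub_left_of_mem_uIcc hy'
  -- Taylor's theorem was applied on the segment between `a` and `x`; its derivatives are those
  -- within `[0, 1]`.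
  rw [iteratedDerivWithin_subset hsub hu hI hf hy'] at h
  rw [← h, taylor_within_apply, Finset.sum_range_succ', Finset.sum_eq_zero]
  · simp
  · intro i hi
    have hi' : i + 1 < k + 1 := by simpa using hi
    rw [iteratedDerivWithin_subset hsub hu hI (hf.of_le (by norm_cast; omega)) left_mem_uIcc,
      h0 _ (by omega) hi', smul_zero]

/-- Expansion of a function near a flat strict maximum of order `2 m`. -/
theorem exists_bounds_of_flat_max {A : ℝ → ℝ} {m : ℕ} (hm : 1 ≤ m) {a δ : ℝ}
    (hA : ContDiffOn ℝ (2 * m + 1 : ℕ) A (Icc 0 1)) (hδ : 0 < δ)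
    (hsub : Icc (a - δ) (a + δ) ⊆ Icc 0 1)
    (h0 : ∀ i : ℕ, 1 ≤ i → i < 2 * m → iteratedDerivWithin i A (Icc 0 1) a = 0)
    (hneg : ∀ x : ℝ, |x - a| ≤ δ → iteratedDerivWithin (2 * m) A (Icc 0 1) x < 0) :
    ∃ κ K : ℝ, 0 < κ ∧ 0 ≤ K ∧ ∀ x, |x - a| ≤ δ →
      A x - A a ≤ -κ * (x - a) ^ (2 * m) ∧
      |A x - A a - coeffC A m a * (x - a) ^ (2 * m)| ≤ K * |x - a| ^ (2 * m + 1) := by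
  have hI : UniqueDiffOn ℝ (Icc (0 : ℝ) 1) := uniqueDiffOn_Icc one_pos
  obtain ⟨k, hk⟩ : ∃ k, 2 * m = k + 1 := ⟨2 * m - 1, by omega⟩
  have hmem : ∀ x, |x - a| ≤ δ → x ∈ Icc (a - δ) (a + δ) := fun x hx => by
    rw [abs_le] at hx; constructor <;> linarith
  have hcont : ContDiffOn ℝ 1 (iteratedDerivWithin (2 * m) A (Icc 0 1)) (Icc 0 1) :=
    ((contDiffOn_nat_succ_iff_contDiffOn_one_iteratedDerivWithin hI).1 (by exact_mod_cast hA)).2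
  obtain ⟨L, hL⟩ := hcont.exists_lipschitzOnWith one_ne_zero (convex_Icc _ _) isCompact_Icc
  -- The largest value of the derivative of order `2 m` on the compact neighbourhood is still
  -- negative and yields `κ`; the Lipschitz constant `L` of that derivative yields `K`.
  obtain ⟨z, hz, hzmax⟩ := (isCompact_Icc (a := a - δ) (b := a + δ)).exists_isMaxOn
    ⟨a, by constructor <;> linarith⟩ (hcont.continuousOn.mono hsub)
  have hfac : (0 : ℝ) < (Nat.factorial (2 * m) : ℝ) := by exact_mod_cast Nat.factorial_pos _
  have hzneg := hneg z (by rw [abs_le]; constructor <;> linarith [hz.1, hz.2])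
  refine ⟨-iteratedDerivWithin (2 * m) A (Icc 0 1) z / (Nat.factorial (2 * m) : ℝ),
    L / (Nat.factorial (2 * m) : ℝ), div_pos (neg_pos.2 hzneg) hfac, by positivity, ?_⟩
  intro x hx
  have haa := hmem a (by simpa using hδ.le)
  obtain ⟨y, hya, hy, h⟩ := exists_sub_eq_iteratedDerivWithin_mul_pow (k := k) (a := a) (x := x)
    (f := A) (hA.of_le (by norm_cast; omega)) (hsub haa) (hsub (hmem x hx))
    (by rw [← hk]; exact h0)
  rw [← hk] at h
  have hev : 0 ≤ (x - a) ^ (2 * m) := (even_two_mul m).pow_nonneg _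
  constructor
  · have h2 : iteratedDerivWithin (2 * m) A (Icc 0 1) y ≤ iteratedDerivWithin (2 * m) A (Icc 0 1) z :=
      hzmax (hmem y (hya.trans hx))
    rw [h, mul_div_right_comm]
    refine mul_le_mul_of_nonneg_right ?_ hev
    rw [neg_div, neg_neg]
    gcongr
  · have h3 := hL.dist_le_mul y hy a (hsub haa)
    rw [Real.dist_eq, Real.dist_eq] at h3
    rw [h, coeffC, mul_div_right_comm, ← sub_mul, ← sub_div, abs_mul, abs_div, abs_of_pos hfac,
      abs_pow, pow_succ, mul_comm (|x - a| ^ (2 * m)), ← mul_assoc]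
    refine mul_le_mul_of_nonneg_right ?_ (by positivity)
    rw [div_mul_eq_mul_div]
    gcongr
    exact h3.trans (by gcongr)

/-- For the quadratic bound, subtracting the tangent line makes the first derivative vanish at `a`,
so the Lagrange form above applies with `k = 1`. -/
theorem exists_bounds_of_contDiffOn_two {B : ℝ → ℝ} (hB : ContDiffOn ℝ 2 B (Icc 0 1)) {a : ℝ}
    (ha : a ∈ Icc (0 : ℝ) 1) :
    ∃ K : ℝ, 0 ≤ K ∧ (∀ x ∈ Icc (0 : ℝ) 1, |B x| ≤ K) ∧
      (∀ x ∈ Icc (0 : ℝ) 1, |B x - B a| ≤ K * |x - a|) ∧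
      ∀ x ∈ Icc (0 : ℝ) 1,
        |B x - B a - derivWithin B (Icc 0 1) a * (x - a)| ≤ K * |x - a| ^ 2 := by
  have hI : UniqueDiffOn ℝ (Icc (0 : ℝ) 1) := uniqueDiffOn_Icc one_pos
  obtain ⟨L, hL⟩ := hB.exists_lipschitzOnWith two_ne_zero (convex_Icc _ _) isCompact_Icc
  obtain ⟨K1, hK1⟩ := isCompact_Icc.exists_bound_of_continuousOn hB.continuousOn
  set d := derivWithin B (Icc 0 1) a with hd
  have hg : ContDiffOn ℝ (1 + 1 : ℕ) (fun x => B x - d * (x - a)) (Icc 0 1) := by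
    refine ContDiffOn.sub (by exact_mod_cast hB) ?_
    exact (contDiff_const.mul (contDiff_id.sub contDiff_const)).contDiffOn
  obtain ⟨K2, hK2⟩ := isCompact_Icc.exists_bound_of_continuousOn
    (hg.continuousOn_iteratedDerivWithin (m := 1 + 1) le_rfl hI)
  have hg1 : ∀ i : ℕ, 1 ≤ i → i < 1 + 1 →
      iteratedDerivWithin i (fun x => B x - d * (x - a)) (Icc 0 1) a = 0 := by
    intro i h1 h2
    obtain rfl : i = 1 := by omega
    rw [iteratedDerivWithin_one]
    have h3 : HasDerivWithinAt B d (Icc 0 1) a :=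
      ((hB.differentiableOn two_ne_zero) a ha).hasDerivWithinAt
    have h4 : HasDerivWithinAt (fun x => d * (x - a)) d (Icc 0 1) a := by
      simpa using (((hasDerivAt_id a).sub_const a).const_mul d).hasDerivWithinAt
    exact ((h3.sub h4).derivWithin (hI a ha)).trans (sub_self d)
  have h0 : (0 : ℝ) ≤ K1 := (norm_nonneg _).trans (hK1 a ha)
  have h0' : (0 : ℝ) ≤ K2 := (norm_nonneg _).trans (hK2 a ha)
  have h0'' : (0 : ℝ) ≤ L := L.2
  refine ⟨K1 + L + K2, by positivity, fun x hx => ?_, fun x hx => ?_, fun x hx => ?_⟩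
  · have := hK1 x hx
    rw [Real.norm_eq_abs] at this
    linarith
  · have := hL.dist_le_mul x hx a ha
    rw [Real.dist_eq, Real.dist_eq] at this
    refine this.trans ?_
    gcongr
    linarith
  · obtain ⟨y, -, hy, h⟩ := exists_sub_eq_iteratedDerivWithin_mul_pow hg ha hx hg1
    have h5 := hK2 y hy
    rw [Real.norm_eq_abs] at h5
    have h6 : B x - B a - d * (x - a) = B x - d * (x - a) - (B a - d * (a - a)) := by ring
    rw [h6, h, abs_div, abs_mul, abs_pow, Nat.abs_cast]
    calc _ ≤ K2 * |x - a| ^ (1 + 1) / 1 := by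
          gcongr
          exact_mod_cast Nat.factorial_pos _
      _ ≤ _ := by
          rw [div_one]
          norm_num only
          gcongr
          linarith

/-! ### Polynomial weights and exponential decay -/

/-- Because `y ^ (2 * m) ≥ |y| - 1`, the decay is at least exponential in `1 + |y|`, which beats any
power by one term of the exponential series. -/
theorem one_add_abs_pow_mul_exp_le {κ : ℝ} (hκ : 0 < κ) {m : ℕ} (hm : 1 ≤ m) (l : ℕ) :
    ∃ C : ℝ, 0 < C ∧ ∀ y : ℝ, (1 + |y|) ^ l * Real.exp (-κ * y ^ (2 * m)) ≤ C := by
  refine ⟨Real.exp (2 * κ) * (Nat.factorial l / κ ^ l), by positivity, fun y => ?_⟩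
  have h1 : |y| - 1 ≤ y ^ (2 * m) := by
    rw [← (even_two_mul m).pow_abs]
    rcases le_total |y| 1 with h | h
    · have : 0 ≤ |y| ^ (2 * m) := by positivity
      linarith
    · have := le_self_pow₀ h (show 2 * m ≠ 0 by omega)
      linarith
  have h2 := Real.pow_div_factorial_le_exp (κ * (1 + |y|)) (by positivity) l
  have hf : (0 : ℝ) < Nat.factorial l := by exact_mod_cast Nat.factorial_pos _
  rw [div_le_iff₀ hf, mul_pow] at h2
  have h3 : Real.exp (-κ * y ^ (2 * m)) ≤ Real.exp (2 * κ) * Real.exp (-(κ * (1 + |y|))) := by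
    rw [← Real.exp_add]
    apply Real.exp_le_exp.2
    nlinarith
  calc (1 + |y|) ^ l * Real.exp (-κ * y ^ (2 * m))
      ≤ (1 + |y|) ^ l * (Real.exp (2 * κ) * Real.exp (-(κ * (1 + |y|)))) := by gcongr
    _ = Real.exp (2 * κ) * ((κ ^ l * (1 + |y|) ^ l) / κ ^ l * Real.exp (-(κ * (1 + |y|)))) := by
        field_simp
    _ ≤ Real.exp (2 * κ) * ((Real.exp (κ * (1 + |y|)) * Nat.factorial l) / κ ^ l *
          Real.exp (-(κ * (1 + |y|)))) := by gcongr
    _ = Real.exp (2 * κ) * (Nat.factorial l / κ ^ l) := by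
        rw [Real.exp_neg]; field_simp

/-- Completing the square, together with `y ^ 2 ≤ y ^ (2 * m) + 1`. It lets a small part of the
leading decay absorb linear errors in the exponent. -/
theorem mul_abs_le_mul_pow_add {η β : ℝ} (hη : 0 < η) {m : ℕ} (hm : 1 ≤ m) (y : ℝ) :
    β * |y| ≤ η * y ^ (2 * m) + (η + β ^ 2 / (4 * η)) := by
  have h1 : y ^ 2 ≤ y ^ (2 * m) + 1 := by
    rw [pow_mul]
    rcases le_total (y ^ 2) 1 with h | h
    · have : 0 ≤ (y ^ 2) ^ m := by positivity
      linarith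
    · have := le_self_pow₀ h (show m ≠ 0 by omega)
      linarith
  have h2 : β * |y| ≤ η * y ^ 2 + β ^ 2 / (4 * η) := by
    have h3 : η * y ^ 2 + β ^ 2 / (4 * η) - β * |y| = (2 * η * |y| - β) ^ 2 / (4 * η) := by
      rw [← sq_abs y]; field_simp; ring
    have : 0 ≤ (2 * η * |y| - β) ^ 2 / (4 * η) := by positivity
    linarith
  nlinarith

theorem abs_exp_sub_exp_le (u v : ℝ) :
    |Real.exp u - Real.exp v| ≤ |u - v| * (Real.exp u + Real.exp v) := by
  have key : ∀ u v : ℝ, v ≤ u → |Real.exp u - Real.exp v| ≤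
      |u - v| * (Real.exp u + Real.exp v) := by
    intro u v h
    have h1 := Real.exp_le_exp.2 h
    have h2 := Real.add_one_le_exp (v - u)
    have h3 : Real.exp v = Real.exp u * Real.exp (v - u) := by rw [← Real.exp_add]; ring_nf
    rw [abs_of_nonneg (by linarith), abs_of_nonneg (by linarith)]
    nlinarith [Real.exp_pos u, Real.exp_pos v]
  rcases le_total v u with h | h
  · exact key u v h
  · rw [abs_sub_comm, abs_sub_comm u, add_comm]
    exact key v u h

/-! ### Comparison of a sum over a grid with an integral -/

/-- The scaled sum is the integral of a step function with value `W k` on the `k`-th cell of length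
`τ`. The cells are disjoint, so `G` need only dominate the error on each cell and `|g|` off all
cells. The case `g = 0` bounds sums. -/
theorem abs_mul_sum_sub_integral_le {τ t : ℝ} (hτ : 0 < τ) (S : Finset ℕ) (W : ℕ → ℝ)
    {g G : ℝ → ℝ} (hg : Integrable g) (hG : Integrable G)
    (hin : ∀ k ∈ S, ∀ u ∈ Ico (τ * (k - t)) (τ * (k - t) + τ), |W k - g u| ≤ G u)
    (hout : ∀ u, (∀ k ∈ S, u ∉ Ico (τ * ((k : ℝ) - t)) (τ * (k - t) + τ)) → |g u| ≤ G u) :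
    |τ * ∑ k ∈ S, W k - ∫ u, g u| ≤ ∫ u, G u := by
  set I : ℕ → Set ℝ := fun k => Ico (τ * (k - t)) (τ * (k - t) + τ) with hI
  have hint : ∀ k ∈ S, Integrable ((I k).indicator fun _ => W k) := fun k _ =>
    (integrable_indicator_iff measurableSet_Ico).2 (integrableOn_const (by simp))
  have hsum : ∫ u, ∑ k ∈ S, (I k).indicator (fun _ => W k) u = τ * ∑ k ∈ S, W k := by
    rw [integral_finsetSum _ hint, Finset.mul_sum]
    refine Finset.sum_congr rfl fun k _ => ?_
    rw [integral_indicator measurableSet_Ico, setIntegral_const]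
    simp [Measure.real, hτ.le]
  rw [← hsum, ← integral_sub (integrable_finsetSum _ hint) hg, ← Real.norm_eq_abs]
  refine norm_integral_le_of_norm_le hG (ae_of_all _ fun u => ?_)
  rw [Real.norm_eq_abs]
  by_cases h : ∃ k ∈ S, u ∈ I k
  · obtain ⟨k, hk, hu⟩ := h
    rw [Finset.sum_eq_single k]
    · rw [indicator_of_mem hu]
      exact hin k hk u hu
    · intro l _ hlk
      refine indicator_of_notMem (fun hl => hlk ?_) _
      have h1 : τ * (l - t) < τ * (k - t) + τ := hl.1.trans_lt hu.2
      have h2 : τ * (k - t) < τ * (l - t) + τ := hu.1.trans_lt hl.2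
      have h3 : (l : ℝ) < k + 1 := by nlinarith
      have h4 : (k : ℝ) < l + 1 := by nlinarith
      have h5 : l < k + 1 := by exact_mod_cast h3
      have h6 : k < l + 1 := by exact_mod_cast h4
      omega
    · exact fun h => absurd hk h
  · push Not at h
    rw [Finset.sum_eq_zero fun k hk => indicator_of_notMem (h k hk) _, zero_sub, abs_neg]
    exact hout u h

/-- Moves quadratic decay from the left end of a cell to all its points, giving an envelope of
integral `π`. -/
theorem inv_one_add_abs_sq_le {z u : ℝ} (h : |u - z| ≤ 1) :
    ((1 + |z|) ^ 2)⁻¹ ≤ 4 * (1 + u ^ 2)⁻¹ := by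
  have h1 : |u| ≤ |z| + 1 := by
    have := abs_sub_abs_le_abs_sub u z
    linarith
  have h2 : 1 + u ^ 2 ≤ 4 * (1 + |z|) ^ 2 := by
    have := sq_abs u
    nlinarith [abs_nonneg z, abs_nonneg u]
  have h3 : (0 : ℝ) < 1 + u ^ 2 := by positivity
  have h4 : 0 < 1 + |z| := by positivity
  rw [← div_eq_mul_inv, inv_le_comm₀ (by positivity) (by positivity), inv_div, div_le_iff₀ (by norm_num)]
  linarith

/-- Grid points of the window. -/
noncomputable def gridWindow (n : ℕ) (a δ : ℝ) : Finset ℕ :=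
  (Finset.range (n + 1)).filter fun k => |(k : ℝ) - n * a| ≤ n * δ

theorem mem_gridWindow {n : ℕ} {a δ : ℝ} {k : ℕ} :
    k ∈ gridWindow n a δ ↔ k ≤ n ∧ |(k : ℝ) - n * a| ≤ n * δ := by
  simp [gridWindow]

/-! ### The conditional law -/

section Law

variable {Ω : Type*} [MeasurableSpace Ω] {P : Measure Ω} {X : Ω → ℕ}
  {m n : ℕ} {An Bn : ℕ → ℝ → ℝ}

theorem partition_pos : 0 < partition m An Bn n :=
  Finset.sum_pos (fun _ _ => Real.exp_pos _) ⟨0, by simp⟩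

/-- The prescribed masses at `0, ..., n` already sum to `1`. -/
theorem HasGibbsLaw.ae_le [IsProbabilityMeasure P] (hX : Measurable X) (h : HasGibbsLaw P X m An Bn n) :
    ∀ᵐ k ∂(P.map X), k ≤ n := by
  have hp := partition_pos (m := m) (n := n) (An := An) (Bn := Bn)
  have h1 : (P.map X) (Finset.range (n + 1) : Set ℕ) = 1 := by
    rw [← sum_measure_singleton]
    have : ∀ k ∈ Finset.range (n + 1), (P.map X) {k} =
        ENNReal.ofReal (Real.exp (hamiltonian m An Bn n ((k : ℝ) / n)) / partition m An Bn n) :=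
      fun k hk => by
        rw [Measure.map_apply hX (measurableSet_singleton k), ← h k (by simpa [Nat.lt_succ_iff] using hk)]
        rfl
    rw [Finset.sum_congr rfl this, ← ENNReal.ofReal_sum_of_nonneg (fun _ _ => by positivity),
      ← Finset.sum_div]
    change ENNReal.ofReal (partition m An Bn n / partition m An Bn n) = 1
    rw [div_self hp.ne', ENNReal.ofReal_one]
  have : IsProbabilityMeasure (P.map X) := Measure.isProbabilityMeasure_map hX.aemeasurable
  rw [ae_iff]
  have h3 := (prob_compl_eq_zero_iff (μ := P.map X) (Finset.measurableSet (Finset.range (n + 1)))).2 h1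
  convert h3 using 2
  ext k; simp

theorem HasGibbsLaw.integral_window [IsProbabilityMeasure P] (hX : Measurable X) (h : HasGibbsLaw P X m An Bn n)
    (a δ : ℝ) (ψ : ℕ → ℝ) :
    ∫ ω in window X n a δ, ψ (X ω) ∂P = (partition m An Bn n)⁻¹ *
      ∑ k ∈ gridWindow n a δ, ψ k * Real.exp (hamiltonian m An Bn n ((k : ℝ) / n)) := by
  have hp := partition_pos (m := m) (n := n) (An := An) (Bn := Bn)
  have : IsProbabilityMeasure (P.map X) := Measure.isProbabilityMeasure_map hX.aemeasurable
  set T : Set ℕ := {k | |(k : ℝ) - n * a| ≤ n * δ} with hT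
  have hw : window X n a δ = X ⁻¹' T := rfl
  rw [hw, ← setIntegral_map (s := T) (f := ψ) MeasurableSet.of_discrete
    (measurable_from_nat.aestronglyMeasurable) hX.aemeasurable]
  have hae : T =ᵐ[P.map X] (gridWindow n a δ : Set ℕ) := by
    filter_upwards [h.ae_le hX] with k hk
    refine propext ?_
    change k ∈ T ↔ k ∈ (gridWindow n a δ : Set ℕ)
    rw [Finset.mem_coe, mem_gridWindow, hT]
    simp [hk]
  rw [setIntegral_congr_set hae, setIntegral_finset _ IntegrableOn.finset, Finset.mul_sum]
  refine Finset.sum_congr rfl fun k hk => ?_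
  have h1 : (P.map X).real {k} =
      Real.exp (hamiltonian m An Bn n ((k : ℝ) / n)) / partition m An Bn n := by
    rw [Measure.real, Measure.map_apply hX (measurableSet_singleton k)]
    change (P {ω | X ω = k}).toReal = _
    rw [h k (mem_gridWindow.1 hk).1, ENNReal.toReal_ofReal (by positivity)]
  rw [h1, smul_eq_mul]
  field_simp

/-- The partition function cancels. A null window is allowed: its grid is then empty and both sides
are `0`. -/
theorem HasGibbsLaw.integral_cond [IsProbabilityMeasure P] (hX : Measurable X) (h : HasGibbsLaw P X m An Bn n)
    (a δ : ℝ) (ψ : ℕ → ℝ) :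
    ∫ ω, ψ (X ω) ∂(ProbabilityTheory.cond P (window X n a δ)) =
      (∑ k ∈ gridWindow n a δ, ψ k * Real.exp (hamiltonian m An Bn n ((k : ℝ) / n))) /
        ∑ k ∈ gridWindow n a δ, Real.exp (hamiltonian m An Bn n ((k : ℝ) / n)) := by
  have hp := partition_pos (m := m) (n := n) (An := An) (Bn := Bn)
  have h1 := h.integral_window hX a δ fun _ => 1
  simp only [integral_const, smul_eq_mul, mul_one, one_mul, measureReal_restrict_apply_univ] at h1
  rw [ProbabilityTheory.cond, integral_smul_measure, h.integral_window hX, ENNReal.toReal_inv]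
  change (P.real (window X n a δ))⁻¹ • _ = _
  rw [h1, smul_eq_mul, mul_inv, inv_inv]
  field_simp

theorem HasGibbsLaw.window_ne_zero (h : HasGibbsLaw P X m An Bn n) {a δ : ℝ} {k : ℕ}
    (hk : k ∈ gridWindow n a δ) : P (window X n a δ) ≠ 0 := by
  have hp := partition_pos (m := m) (n := n) (An := An) (Bn := Bn)
  rw [mem_gridWindow] at hk
  have h1 : 0 < P {ω | X ω = k} := by
    rw [h k hk.1, ENNReal.ofReal_pos]
    positivity
  refine (h1.trans_le (measure_mono ?_)).ne'
  rintro ω rfl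
  exact hk.2

end Law

/-! ### The limiting density -/

/-- The unnormalised density of `limitLaw`. -/
noncomputable def tilt (m : ℕ) (c b y : ℝ) : ℝ := Real.exp (c * y ^ (2 * m) + b * y)

theorem tilt_pos (m : ℕ) (c b y : ℝ) : 0 < tilt m c b y := Real.exp_pos _

theorem continuous_tilt (m : ℕ) (c b : ℝ) : Continuous (tilt m c b) := by
  unfold tilt; fun_prop

theorem exists_exponent_le {m : ℕ} (hm : 1 ≤ m) {c : ℝ} (hc : c < 0) (b : ℝ) :
    ∃ K : ℝ, 0 ≤ K ∧ ∀ y : ℝ, c * y ^ (2 * m) + b * y ≤ K - (-c / 2) * y ^ (2 * m) := by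
  refine ⟨-c / 2 + |b| ^ 2 / (4 * (-c / 2)), ?_, fun y => ?_⟩
  · have : 0 < -c := by linarith
    positivity
  · have h1 := mul_abs_le_mul_pow_add (β := |b|) (show 0 < -c / 2 by linarith) hm y
    have h2 : b * y ≤ |b| * |y| := by rw [← abs_mul]; exact le_abs_self _
    linarith

theorem exists_pow_mul_tilt_le {m : ℕ} (hm : 1 ≤ m) {c : ℝ} (hc : c < 0) (b : ℝ) (l : ℕ) :
    ∃ C : ℝ, 0 < C ∧ ∀ y : ℝ, (1 + |y|) ^ l * tilt m c b y ≤ C := by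
  obtain ⟨K, -, hK⟩ := exists_exponent_le hm hc b
  obtain ⟨C, hC, h⟩ := one_add_abs_pow_mul_exp_le (show 0 < -c / 2 by linarith) hm l
  refine ⟨C * Real.exp K, by positivity, fun y => ?_⟩
  have h1 : tilt m c b y ≤ Real.exp (-(-c / 2) * y ^ (2 * m)) * Real.exp K := by
    rw [← Real.exp_add]
    exact Real.exp_le_exp.2 (by linarith [hK y])
  calc _ ≤ (1 + |y|) ^ l * (Real.exp (-(-c / 2) * y ^ (2 * m)) * Real.exp K) := by gcongr
    _ = ((1 + |y|) ^ l * Real.exp (-(-c / 2) * y ^ (2 * m))) * Real.exp K := by ring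
    _ ≤ _ := by gcongr; exact h y

theorem one_add_sq_le (u : ℝ) : 1 + u ^ 2 ≤ (1 + |u|) ^ 2 := by
  have := sq_abs u
  nlinarith [abs_nonneg u]

theorem integrable_mul_tilt {m : ℕ} (hm : 1 ≤ m) {c : ℝ} (hc : c < 0) (b : ℝ) {φ : ℝ → ℝ}
    (hφ : Continuous φ) (hφ' : ∀ x, |φ x| ≤ 1 + |x|) :
    Integrable fun y => φ y * tilt m c b y := by
  obtain ⟨C, hC, h⟩ := exists_pow_mul_tilt_le hm hc b 3
  refine (integrable_inv_one_add_sq.const_mul C).mono'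
    (hφ.mul (continuous_tilt m c b)).aestronglyMeasurable (ae_of_all _ fun y => ?_)
  rw [Real.norm_eq_abs, abs_mul, abs_of_pos (tilt_pos m c b y), ← div_eq_mul_inv,
    le_div_iff₀ (by positivity)]
  calc |φ y| * tilt m c b y * (1 + y ^ 2) ≤ (1 + |y|) * tilt m c b y * (1 + |y|) ^ 2 := by
        have := tilt_pos m c b y
        gcongr
        · exact hφ' y
        · exact one_add_sq_le y
    _ = (1 + |y|) ^ 3 * tilt m c b y := by ring
    _ ≤ C := h y

theorem integrable_tilt {m : ℕ} (hm : 1 ≤ m) {c : ℝ} (hc : c < 0) (b : ℝ) :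
    Integrable (tilt m c b) := by
  simpa using integrable_mul_tilt hm hc b (φ := fun _ => 1) continuous_const
    (fun x => by simp)

theorem integral_tilt_pos {m : ℕ} (hm : 1 ≤ m) {c : ℝ} (hc : c < 0) (b : ℝ) :
    0 < ∫ y, tilt m c b y :=
  integral_exp_pos (integrable_tilt hm hc b)

theorem integral_limitLaw {m : ℕ} (hm : 1 ≤ m) {c : ℝ} (hc : c < 0) (b : ℝ) (h : ℝ → ℝ) :
    ∫ x, h x ∂(limitLaw m c b) = (∫ x, h x * tilt m c b x) / ∫ y, tilt m c b y := by
  have hD := integral_tilt_pos hm hc b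
  have h1 : limitLaw m c b = volume.withDensity fun x =>
      ((Real.toNNReal (tilt m c b x / ∫ y, tilt m c b y) : ℝ≥0) : ℝ≥0∞) := rfl
  have h2 : Measurable fun x => Real.toNNReal (tilt m c b x / ∫ y, tilt m c b y) :=
    ((continuous_tilt m c b).measurable.div_const _).real_toNNReal
  rw [h1, integral_withDensity_eq_integral_smul h2, ← integral_div]
  refine integral_congr_ae (ae_of_all _ fun x => ?_)
  have := tilt_pos m c b x
  simp only [NNReal.smul_def, smul_eq_mul]
  rw [Real.coe_toNNReal _ (by positivity)]
  ring

theorem exists_abs_tilt_sub_le (m : ℕ) (c b : ℝ) :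
    ∃ K : ℝ, 0 ≤ K ∧ ∀ z u : ℝ, |u - z| ≤ 1 →
      |tilt m c b z - tilt m c b u| ≤
        |u - z| * (K * (1 + |z|) ^ (2 * m) * (tilt m c b z + tilt m c b u)) := by
  refine ⟨|c| * (2 * m : ℕ) + |b|, by positivity, fun z u h => ?_⟩
  have h1 : |u| ≤ 1 + |z| := by
    have := abs_sub_abs_le_abs_sub u z
    linarith
  have h2 : |z ^ (2 * m) - u ^ (2 * m)| ≤ |u - z| * (2 * m : ℕ) * (1 + |z|) ^ (2 * m) := by
    refine (abs_pow_sub_pow_le ..).trans ?_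
    rw [abs_sub_comm z u]
    gcongr
    calc max |z| |u| ^ (2 * m - 1) ≤ (1 + |z|) ^ (2 * m - 1) := by
          gcongr; exact max_le (by linarith) h1
      _ ≤ _ := pow_le_pow_right₀ (by linarith [abs_nonneg z]) (by omega)
  have h3 : (1 : ℝ) ≤ (1 + |z|) ^ (2 * m) := one_le_pow₀ (by linarith [abs_nonneg z])
  refine (abs_exp_sub_exp_le _ _).trans ?_
  rw [← mul_assoc]
  refine mul_le_mul_of_nonneg_right ?_ (add_pos (tilt_pos m c b z) (tilt_pos m c b u)).le
  calc |c * z ^ (2 * m) + b * z - (c * u ^ (2 * m) + b * u)|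
      = |c * (z ^ (2 * m) - u ^ (2 * m)) + b * (z - u)| := by ring_nf
    _ ≤ |c| * |z ^ (2 * m) - u ^ (2 * m)| + |b| * |u - z| := by
        refine (abs_add_le _ _).trans ?_
        rw [abs_mul, abs_mul, abs_sub_comm z u]
    _ ≤ |c| * (|u - z| * (2 * m : ℕ) * (1 + |z|) ^ (2 * m)) +
          |b| * |u - z| * (1 + |z|) ^ (2 * m) := by
        exact add_le_add (by gcongr) (le_mul_of_one_le_right (by positivity) h3)
    _ = _ := by ring

/-- Around each point of the grid, the step function with the given weights is close to the
limiting density. -/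
theorem exists_abs_weight_sub_le {m : ℕ} (hm : 1 ≤ m) {c : ℝ} (hc : c < 0) (b : ℝ) {K₀ : ℝ}
    (hK₀ : 0 ≤ K₀) :
    ∃ C : ℝ, 0 < C ∧ ∀ (r z u w : ℝ) (φ : ℝ → ℝ), |u - z| ≤ 1 → |u - z| ≤ r →
      |w - tilt m c b z| * (1 + |z|) ^ 3 ≤ K₀ * r →
      (∀ x y, |φ x - φ y| ≤ |x - y|) → (∀ x, |φ x| ≤ 1 + |x|) →
      |φ z * w - φ u * tilt m c b u| ≤ C * r * (1 + u ^ 2)⁻¹ := by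
  obtain ⟨K, hK, hsub⟩ := exists_abs_tilt_sub_le m c b
  obtain ⟨C₁, hC₁, h₁⟩ := exists_pow_mul_tilt_le hm hc b (2 * m + 3)
  obtain ⟨C₂, hC₂, h₂⟩ := exists_pow_mul_tilt_le hm hc b 2
  refine ⟨(K₀ + K * (C₁ + 2 ^ (2 * m + 3) * C₁) + 4 * C₂) * 4, by positivity, ?_⟩
  intro r z u w φ hu1 hur hw hφL hφ
  have hr : 0 ≤ r := (abs_nonneg _).trans hur
  set ρ := 1 + |z| with hρ
  have hρ1 : 1 ≤ ρ := by linarith [abs_nonneg z]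
  have hzu : ρ ≤ 2 * (1 + |u|) := by
    have := abs_sub_abs_le_abs_sub z u
    rw [abs_sub_comm] at this
    linarith [abs_nonneg u]
  have htz := tilt_pos m c b z
  have htu := tilt_pos m c b u
  have e2 : ρ ^ (2 * m + 3) * tilt m c b u ≤ 2 ^ (2 * m + 3) * C₁ := by
    calc _ ≤ (2 * (1 + |u|)) ^ (2 * m + 3) * tilt m c b u := by gcongr
      _ = 2 ^ (2 * m + 3) * ((1 + |u|) ^ (2 * m + 3) * tilt m c b u) := by rw [mul_pow]; ring
      _ ≤ _ := by gcongr; exact h₁ u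
  have e3 : ρ ^ 2 * tilt m c b u ≤ 4 * C₂ := by
    calc _ ≤ (2 * (1 + |u|)) ^ 2 * tilt m c b u := by gcongr
      _ = 4 * ((1 + |u|) ^ 2 * tilt m c b u) := by ring
      _ ≤ _ := by gcongr; exact h₂ u
  have t1 : |φ z * (w - tilt m c b z)| * ρ ^ 2 ≤ K₀ * r := by
    rw [abs_mul]
    calc |φ z| * |w - tilt m c b z| * ρ ^ 2 ≤ ρ * |w - tilt m c b z| * ρ ^ 2 := by
          gcongr; exact hφ z
      _ = |w - tilt m c b z| * ρ ^ 3 := by ring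
      _ ≤ _ := hw
  have t2 : |φ z * (tilt m c b z - tilt m c b u)| * ρ ^ 2 ≤
      r * (K * (C₁ + 2 ^ (2 * m + 3) * C₁)) := by
    rw [abs_mul]
    calc |φ z| * |tilt m c b z - tilt m c b u| * ρ ^ 2
        ≤ ρ * (r * (K * ρ ^ (2 * m) * (tilt m c b z + tilt m c b u))) * ρ ^ 2 := by
          gcongr
          · exact hφ z
          · exact (hsub z u hu1).trans (by gcongr)
      _ = r * (K * (ρ ^ (2 * m + 3) * tilt m c b z + ρ ^ (2 * m + 3) * tilt m c b u)) := by ring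
      _ ≤ _ := by gcongr; exact h₁ z
  have t3 : |(φ z - φ u) * tilt m c b u| * ρ ^ 2 ≤ r * (4 * C₂) := by
    rw [abs_mul, abs_of_pos htu, mul_assoc, mul_comm (tilt m c b u)]
    have : |φ z - φ u| ≤ r := (hφL z u).trans (by rwa [abs_sub_comm])
    gcongr
  -- Three errors: the weight, the density moved from `z` to `u`, and `φ` moved from `z` to `u`. Of
  -- the cube in `hw`, one factor `ρ` pays for the growth of `φ` and two remain for the integrable
  -- envelope.
  have key : |φ z * w - φ u * tilt m c b u| * ρ ^ 2 ≤
      (K₀ + K * (C₁ + 2 ^ (2 * m + 3) * C₁) + 4 * C₂) * r := by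
    have e : φ z * w - φ u * tilt m c b u = φ z * (w - tilt m c b z) +
        φ z * (tilt m c b z - tilt m c b u) + (φ z - φ u) * tilt m c b u := by ring
    rw [e]
    calc _ ≤ (|φ z * (w - tilt m c b z)| + |φ z * (tilt m c b z - tilt m c b u)| +
          |(φ z - φ u) * tilt m c b u|) * ρ ^ 2 := by gcongr; exact abs_add_three _ _ _
      _ ≤ _ := by linarith
  rw [← le_div_iff₀ (by positivity), div_eq_mul_inv] at key
  refine key.trans ?_
  calc _ ≤ (K₀ + K * (C₁ + 2 ^ (2 * m + 3) * C₁) + 4 * C₂) * r * (4 * (1 + u ^ 2)⁻¹) := by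
        gcongr; exact inv_one_add_abs_sq_le hu1
    _ = _ := by ring

/-! ### Riemann sums over the window -/

/-- The candidate index is the floor of `u / τ + n a`. If it leaves the window, then `u` is itself
at distance at least `s δ - 1` from `0`, since a cell has length at most `1`. -/
theorem exists_mem_gridWindow_or {n : ℕ} (hn : 1 ≤ n) {a δ s : ℝ} (hs : 1 ≤ s) (hsn : s ≤ n)
    (hsub : Icc (a - δ) (a + δ) ⊆ Icc 0 1) (hδ : 0 < δ) (u : ℝ) :
    (∃ k ∈ gridWindow n a δ, u ∈ Ico (s / n * ((k : ℝ) - n * a)) (s / n * (k - n * a) + s / n)) ∨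
      s * δ ≤ 1 + |u| := by
  have hn0 : (0 : ℝ) < n := by exact_mod_cast hn
  set τ := s / n with hτ
  have hτ0 : 0 < τ := by positivity
  have hτ1 : τ ≤ 1 := by rw [hτ, div_le_one hn0]; exact hsn
  have hτn : τ * n = s := by rw [hτ]; field_simp
  set v := u / τ + n * a with hv
  have hu : u = τ * (v - n * a) := by rw [hv]; field_simp; ring
  have hk1 := Int.floor_le v
  have hk2 := Int.lt_floor_add_one v
  have h0 := (hsub (left_mem_Icc.2 (by linarith))).1
  have h1 := (hsub (right_mem_Icc.2 (by linarith))).2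
  by_cases h : |(⌊v⌋ : ℝ) - n * a| ≤ n * δ
  · left
    have h2 := abs_le.1 h
    have h3 : (0 : ℝ) ≤ ⌊v⌋ := by nlinarith
    have h4 : (⌊v⌋ : ℝ) ≤ n := by nlinarith
    obtain ⟨k, hk⟩ := Int.eq_ofNat_of_zero_le (show (0 : ℤ) ≤ ⌊v⌋ by exact_mod_cast h3)
    have hkv : (⌊v⌋ : ℝ) = k := by rw [hk]; simp
    rw [hkv] at h h4 hk1 hk2
    refine ⟨k, mem_gridWindow.2 ⟨by exact_mod_cast h4, h⟩, ?_, ?_⟩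
    · rw [hu]; gcongr
    · rw [hu]; nlinarith
  · right
    push Not at h
    have h2 : |(⌊v⌋ : ℝ) - n * a| ≤ |v - n * a| + 1 := by
      have h3 : |(⌊v⌋ : ℝ) - v| ≤ 1 := by rw [abs_le]; constructor <;> linarith
      have h4 := abs_sub_le (⌊v⌋ : ℝ) v (n * a)
      linarith
    have h5 : |u| = τ * |v - n * a| := by rw [hu, abs_mul, abs_of_pos hτ0]
    have h6 : τ * (n * δ) ≤ τ * (|v - n * a| + 1) := by gcongr; linarith
    rw [← mul_assoc, hτn, mul_add, ← h5] at h6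
    linarith

/-- The mesh satisfies `s / n ≤ 1 / s ≤ r` because `s ^ 2 ≤ n`, so each cell contributes a relative
error of order `r`. The constant does not depend on `φ`, as the Wasserstein supremum requires. -/
theorem exists_abs_sum_sub_integral_le {m : ℕ} (hm : 1 ≤ m) {c : ℝ} (hc : c < 0) (b : ℝ)
    {K₀ δ a : ℝ} (hK₀ : 0 ≤ K₀) (hδ : 0 < δ) (hsub : Icc (a - δ) (a + δ) ⊆ Icc 0 1) :
    ∃ C : ℝ, 0 < C ∧ ∀ (n : ℕ) (s r : ℝ) (w : ℕ → ℝ) (φ : ℝ → ℝ), 1 ≤ n → 1 ≤ s → s ^ 2 ≤ n →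
      1 / s ≤ r →
      (∀ k ∈ gridWindow n a δ, |w k - tilt m c b (s * ((k : ℝ) / n - a))| *
        (1 + |s * ((k : ℝ) / n - a)|) ^ 3 ≤ K₀ * r) →
      (∀ x y, |φ x - φ y| ≤ |x - y|) → (∀ x, |φ x| ≤ 1 + |x|) →
      |s / n * ∑ k ∈ gridWindow n a δ, φ (s * ((k : ℝ) / n - a)) * w k -
        ∫ y, φ y * tilt m c b y| ≤ C * r := by
  obtain ⟨C, hC, hin⟩ := exists_abs_weight_sub_le hm hc b hK₀
  obtain ⟨C₄, hC₄, h₄⟩ := exists_pow_mul_tilt_le hm hc b 4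
  refine ⟨(C + C₄ / δ) * Real.pi, by positivity, ?_⟩
  intro n s r w φ hn hs hsn hr hw hφL hφ
  have hn0 : (0 : ℝ) < n := by exact_mod_cast hn
  have hs0 : 0 < s := by linarith
  have hr0 : 0 < r := lt_of_lt_of_le (by positivity) hr
  have hsn' : s ≤ n := by nlinarith
  have hτ : s / n ≤ 1 / s := by rw [div_le_div_iff₀ hn0 hs0]; linarith
  have hτ1 : s / n ≤ 1 := by rw [div_le_one hn0]; exact hsn'
  have hφc : Continuous φ := by
    have : LipschitzWith 1 φ := LipschitzWith.of_dist_le_mul fun x y => by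
      simpa [Real.dist_eq] using hφL x y
    exact this.continuous
  have hy : ∀ k : ℕ, s * ((k : ℝ) / n - a) = s / n * (k - n * a) := fun k => by
    field_simp
  have hGi : Integrable fun u : ℝ => (C + C₄ / δ) * r * (1 + u ^ 2)⁻¹ :=
    integrable_inv_one_add_sq.const_mul _
  have hmain := abs_mul_sum_sub_integral_le (τ := s / n) (t := n * a) (by positivity)
    (gridWindow n a δ) (fun k => φ (s * ((k : ℝ) / n - a)) * w k)
    (integrable_mul_tilt hm hc b hφc hφ) hGi ?_ ?_
  · refine hmain.trans_eq ?_
    rw [integral_const_mul, integral_univ_inv_one_add_sq]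
    ring
  · intro k hk u hu
    rw [← hy] at hu
    have h1 : |u - s * ((k : ℝ) / n - a)| ≤ s / n := by
      rw [abs_le]; constructor <;> linarith [hu.1, hu.2, show 0 < s / n by positivity]
    refine (hin r _ u _ φ (h1.trans hτ1) ((h1.trans hτ).trans hr) (hw k hk) hφL hφ).trans ?_
    gcongr
    have : 0 < C₄ / δ := by positivity
    linarith
  · intro u hu
    have h1 : s * δ ≤ 1 + |u| := by
      rcases exists_mem_gridWindow_or hn hs hsn' hsub hδ u with ⟨k, hk, hk'⟩ | h
      · exact absurd hk' (hu k hk)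
      · exact h
    have ht := tilt_pos m c b u
    rw [abs_mul, abs_of_pos ht, ← div_eq_mul_inv, le_div_iff₀ (by positivity)]
    -- Off the cells, one of the four powers of `1 + |u|` is traded for `s δ`, producing the factor
    -- `1 / s`; one covers `φ` and two the envelope.
    have h2 : s * δ * (|φ u| * tilt m c b u * (1 + u ^ 2)) ≤ C₄ := by
      calc _ ≤ (1 + |u|) * ((1 + |u|) * tilt m c b u * (1 + |u|) ^ 2) := by
            gcongr
            · exact hφ u
            · exact one_add_sq_le u
        _ = (1 + |u|) ^ 4 * tilt m c b u := by ring
        _ ≤ _ := h₄ u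
    rw [← le_div_iff₀' (by positivity)] at h2
    refine h2.trans ?_
    calc C₄ / (s * δ) = C₄ / δ * (1 / s) := by field_simp
      _ ≤ C₄ / δ * r := by gcongr
      _ ≤ _ := by nlinarith

/-- Sums over the grid of weights with quadratic decay are bounded. -/
theorem abs_sum_le_of_decay {n : ℕ} {s : ℝ} (hs : 1 ≤ s) (hsn : s ≤ n) {a δ K : ℝ}
    (hK : 0 ≤ K) (W : ℕ → ℝ)
    (hW : ∀ k ∈ gridWindow n a δ, |W k| * (1 + |s * ((k : ℝ) / n - a)|) ^ 2 ≤ K) :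
    |s / n * ∑ k ∈ gridWindow n a δ, W k| ≤ K * 4 * Real.pi := by
  have hn0 : (0 : ℝ) < n := by linarith
  have hτ1 : s / n ≤ 1 := by rw [div_le_one hn0]; exact hsn
  have hy : ∀ k : ℕ, s * ((k : ℝ) / n - a) = s / n * (k - n * a) := fun k => by
    field_simp
  have hmain := abs_mul_sum_sub_integral_le (τ := s / n) (t := n * a) (by positivity)
    (gridWindow n a δ) W (g := fun _ => 0) (integrable_zero _ _ _)
    (integrable_inv_one_add_sq.const_mul (K * 4)) ?_ ?_
  · simpa [integral_const_mul, integral_univ_inv_one_add_sq] using hmain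
  · intro k hk u hu
    rw [← hy] at hu
    have h1 : |u - s * ((k : ℝ) / n - a)| ≤ 1 := by
      rw [abs_le]; constructor <;> linarith [hu.1, hu.2, show 0 < s / n by positivity]
    have h2 := hW k hk
    rw [← le_div_iff₀ (by positivity), div_eq_mul_inv] at h2
    rw [sub_zero]
    refine h2.trans ?_
    rw [mul_assoc]
    gcongr
    exact inv_one_add_abs_sq_le h1
  · intro u _
    simp only [abs_zero]
    positivity

/-! ### Scales -/

/-- The scale `n ^ (1 / (2 m))`. -/
noncomputable def scale (m n : ℕ) : ℝ := (n : ℝ) ^ (1 / (2 * (m : ℝ)))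

/-- The rate of convergence in the Wasserstein distance. -/
noncomputable def rate (m M n : ℕ) : ℝ :=
  (n : ℝ) ^ (-1 / (2 * (m : ℝ))) +
    if m ≠ M then (n : ℝ) ^ (1 / (2 * (M : ℝ)) - 1 / (2 * (m : ℝ))) else 0

theorem one_le_scale (m : ℕ) {n : ℕ} (hn : 1 ≤ n) : 1 ≤ scale m n :=
  Real.one_le_rpow (by exact_mod_cast hn) (by positivity)

theorem scale_pow {m : ℕ} (hm : 1 ≤ m) (n : ℕ) : scale m n ^ (2 * m) = n := by
  have : (m : ℝ) ≠ 0 := by positivity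
  rw [scale, ← Real.rpow_natCast, ← Real.rpow_mul (Nat.cast_nonneg n)]
  push_cast
  rw [one_div, inv_mul_cancel₀ (by positivity), Real.rpow_one]

theorem scale_sq_le {m : ℕ} (hm : 1 ≤ m) {n : ℕ} (hn : 1 ≤ n) : scale m n ^ 2 ≤ n :=
  (pow_le_pow_right₀ (one_le_scale m hn) (by omega)).trans_eq (scale_pow hm n)

theorem scale_anti {m M : ℕ} (hm : 1 ≤ m) (hmM : m ≤ M) {n : ℕ} (hn : 1 ≤ n) :
    scale M n ≤ scale m n := by
  refine Real.rpow_le_rpow_of_exponent_le (by exact_mod_cast hn) ?_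
  gcongr

theorem mul_sigma (M : ℕ) {n : ℕ} (hn : 1 ≤ n) : n * sigma M n = scale M n := by
  have : (0 : ℝ) < n := by exact_mod_cast hn
  rw [sigma, scale, Real.rpow_add this, Real.rpow_neg_one]
  field_simp

theorem rpow_neg_eq_inv_scale (m n : ℕ) : (n : ℝ) ^ (-1 / (2 * (m : ℝ))) = 1 / scale m n := by
  rw [scale, neg_div, Real.rpow_neg (Nat.cast_nonneg n)]
  exact (one_div _).symm

theorem rate_eq (m M : ℕ) {n : ℕ} (hn : 1 ≤ n) :
    rate m M n = 1 / scale m n + if m ≠ M then scale M n / scale m n else 0 := by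
  have : (0 : ℝ) < n := by exact_mod_cast hn
  rw [rate, rpow_neg_eq_inv_scale, Real.rpow_sub this]
  rfl

theorem inv_scale_le_rate (m M : ℕ) {n : ℕ} (hn : 1 ≤ n) : 1 / scale m n ≤ rate m M n := by
  have h1 := one_le_scale m hn
  have h2 := one_le_scale M hn
  rw [rate_eq m M hn]
  split_ifs
  · have : 0 ≤ scale M n / scale m n := by positivity
    linarith
  · simp

theorem rpow_neg_div_eq {m : ℕ} (n l : ℕ) :
    (n : ℝ) ^ (-(l : ℝ) / (2 * (m : ℝ))) = (scale m n ^ l)⁻¹ := by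
  rw [scale, ← Real.rpow_natCast, ← Real.rpow_mul (Nat.cast_nonneg n), neg_div,
    Real.rpow_neg (Nat.cast_nonneg n)]
  congr 2
  ring

/-! ### Deterministic estimates of the exponent -/

set_option maxHeartbeats 1000000 in
/-- Expansion of the exponent at a point of the open window. -/
theorem abs_exponent_sub_le {m : ℕ} (hm : 1 ≤ m) {n s T r C KA KB c b d d₀ : ℝ}
    {Ax Aa A0 Anx An0 Bx Ba B0 Bnx Bn0 κ : ℝ}
    (hs : 1 ≤ s) (hspow : s ^ (2 * m) = n) (hsn : s ^ 2 ≤ n) (hT : 1 ≤ T) (hTs : T ≤ s)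
    (hr : 1 / s ≤ r) (hC : 0 ≤ C) (hKA : 0 ≤ KA) (hKB : 0 ≤ KB)
    (hd₀ : |d₀| ≤ 1 / n)
    (hA : |Ax - Aa - c * d ^ (2 * m)| ≤ KA * |d| ^ (2 * m + 1))
    (hA' : Ax - Aa ≤ -κ * d ^ (2 * m))
    (hA0 : |A0 - Aa| ≤ KA * |d₀| ^ 2)
    (hinc : |(Anx - An0) - (Ax - A0)| ≤ C * |d - d₀| / n)
    (hBx : |Bnx - Bx| ≤ C / n) (hBn0 : |Bn0 - B0| ≤ C / n)
    (hB : |Bx - Ba| ≤ KB * |d|) (hB0 : |B0 - Ba| ≤ KB * |d₀|)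
    (hb : |T * (Bx - Ba) - b * (s * d)| ≤ KB * r * (1 + |s * d|) ^ 2) :
    n * (Anx - An0) + T * (Bnx - Bn0) ≤ -κ * (s * d) ^ (2 * m) +
        (3 * C + KA + 2 * KB) * (1 + |s * d|) ∧
      |n * (Anx - An0) + T * (Bnx - Bn0) - (c * (s * d) ^ (2 * m) + b * (s * d))| ≤
        (3 * C + 2 * KA + 2 * KB) * r * (1 + |s * d|) ^ (2 * m + 1) := by
  have hs0 : 0 < s := by linarith
  have hss : s ≤ s ^ 2 := le_self_pow₀ hs two_ne_zero
  have hn1 : 1 ≤ n := by linarith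
  have hn0 : 0 < n := by linarith
  have hsn' : s ≤ n := by linarith
  set y := s * d with hy
  have hds : |d| = |y| / s := by rw [hy, abs_mul, abs_of_pos hs0]; field_simp
  have hinv : 1 / n ≤ 1 / s := one_div_le_one_div_of_le hs0 hsn'
  -- Here `T s ≤ s ^ 2 ≤ n`.
  have hTn : T / n ≤ 1 / s := by rw [div_le_div_iff₀ hn0 hs0]; nlinarith
  have e1 : |n * ((Anx - An0) - (Ax - A0))| ≤ C * (1 + |y|) * (1 / s) := by
    rw [abs_mul, abs_of_pos hn0]
    calc n * |(Anx - An0) - (Ax - A0)| ≤ n * (C * |d - d₀| / n) := by gcongr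
      _ = C * |d - d₀| := by field_simp
      _ ≤ C * (|y| / s + 1 / s) := by
          gcongr
          refine (abs_sub _ _).trans ?_
          rw [hds]; linarith
      _ = _ := by ring
  have e2 : |T * ((Bnx - Bx) - (Bn0 - B0))| ≤ 2 * C * (1 / s) := by
    rw [abs_mul, abs_of_pos (by linarith)]
    calc T * |(Bnx - Bx) - (Bn0 - B0)| ≤ T * (C / n + C / n) := by
          gcongr
          exact (abs_sub _ _).trans (add_le_add hBx hBn0)
      _ = 2 * C * (T / n) := by ring
      _ ≤ _ := by gcongr
  have e3 : |n * (A0 - Aa)| ≤ KA * (1 / s) := by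
    rw [abs_mul, abs_of_pos hn0]
    calc n * |A0 - Aa| ≤ n * (KA * (1 / n) ^ 2) := by
          gcongr
          exact hA0.trans (by gcongr)
      _ = KA * (1 / n) := by field_simp
      _ ≤ _ := by gcongr
  have e4 : |T * (B0 - Ba)| ≤ KB * (1 / s) := by
    rw [abs_mul, abs_of_pos (by linarith)]
    calc T * |B0 - Ba| ≤ T * (KB * (1 / n)) := by
          gcongr
          exact hB0.trans (by gcongr)
      _ = KB * (T / n) := by ring
      _ ≤ _ := by gcongr
  have e5 : |n * (Ax - Aa) - c * y ^ (2 * m)| ≤ KA * |y| ^ (2 * m + 1) * (1 / s) := by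
    have : n * (Ax - Aa) - c * y ^ (2 * m) = n * (Ax - Aa - c * d ^ (2 * m)) := by
      rw [hy, mul_pow, hspow]; ring
    rw [this, abs_mul, abs_of_pos hn0]
    calc n * |Ax - Aa - c * d ^ (2 * m)| ≤ n * (KA * |d| ^ (2 * m + 1)) := by gcongr
      _ = n * (KA * (|y| ^ (2 * m + 1) / (s ^ (2 * m) * s))) := by rw [hds, div_pow, pow_succ s]
      _ = _ := by rw [hspow]; field_simp
  have hy0 := abs_nonneg y
  have hinv1 : 1 / s ≤ 1 := by rw [div_le_one hs0]; exact hs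
  have hinv0 : 0 < 1 / s := by positivity
  -- Two main terms and four errors, each with a factor `1 / s`: replacing `A_n` and `B_n` by `A`
  -- and `B`, and moving the base point from the grid to the maximizer.
  have hdec : n * (Anx - An0) + T * (Bnx - Bn0) = n * (Ax - Aa) + T * (Bx - Ba) +
      n * ((Anx - An0) - (Ax - A0)) + T * ((Bnx - Bx) - (Bn0 - B0)) - n * (A0 - Aa) -
      T * (B0 - Ba) := by ring
  rw [hdec]
  constructor
  · have h1 : n * (Ax - Aa) ≤ -κ * y ^ (2 * m) := by
      calc _ ≤ n * (-κ * d ^ (2 * m)) := by gcongr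
        _ = _ := by rw [hy, mul_pow, hspow]; ring
    have h2 : T * (Bx - Ba) ≤ KB * |y| := by
      calc T * (Bx - Ba) ≤ T * (KB * |d|) := by gcongr; exact (le_abs_self _).trans hB
        _ ≤ s * (KB * (|y| / s)) := by rw [hds]; gcongr
        _ = _ := by field_simp
    have f1 := (abs_le.1 e1).2
    have f2 := (abs_le.1 e2).2
    have f3 := (abs_le.1 e3).1
    have f4 := (abs_le.1 e4).1
    have g1 : C * (1 + |y|) * (1 / s) ≤ C * (1 + |y|) := mul_le_of_le_one_right (by positivity) hinv1
    have g2 : 2 * C * (1 / s) ≤ 2 * C := mul_le_of_le_one_right (by positivity) hinv1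
    have g3 : KA * (1 / s) ≤ KA := mul_le_of_le_one_right hKA hinv1
    have g4 : KB * (1 / s) ≤ KB := mul_le_of_le_one_right hKB hinv1
    have g5 := mul_nonneg hC hy0
    have g6 := mul_nonneg hKA hy0
    have g7 := mul_nonneg hKB hy0
    linarith
  · have hr0 : 0 < r := hinv0.trans_le hr
    have hρ : 1 ≤ 1 + |y| := by linarith
    set R := (1 + |y|) ^ (2 * m + 1) with hR
    have r0 : 1 ≤ R := one_le_pow₀ hρ
    have r1 : 1 + |y| ≤ R := le_self_pow₀ hρ (by omega)
    have r2 : (1 + |y|) ^ 2 ≤ R := pow_le_pow_right₀ hρ (by omega)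
    have hRr : 1 / s ≤ R * r := hr.trans (le_mul_of_one_le_left hr0.le r0)
    have r3 : |y| ^ (2 * m + 1) ≤ R := by rw [hR]; gcongr; linarith
    have f1 : |n * ((Anx - An0) - (Ax - A0))| ≤ C * (R * r) := e1.trans (by
      rw [mul_assoc]; gcongr)
    have f2 : |T * ((Bnx - Bx) - (Bn0 - B0))| ≤ 2 * C * (R * r) := e2.trans (by
      gcongr)
    have f3 : |n * (A0 - Aa)| ≤ KA * (R * r) := e3.trans (by
      gcongr)
    have f4 : |T * (B0 - Ba)| ≤ KB * (R * r) := e4.trans (by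
      gcongr)
    have f5 : |n * (Ax - Aa) - c * y ^ (2 * m)| ≤ KA * (R * r) := e5.trans (by
      rw [mul_assoc]; gcongr)
    have f6 : |T * (Bx - Ba) - b * y| ≤ KB * (R * r) := hb.trans (by
      rw [mul_assoc, mul_comm R]; gcongr)
    rw [show n * (Ax - Aa) + T * (Bx - Ba) + n * ((Anx - An0) - (Ax - A0)) +
      T * ((Bnx - Bx) - (Bn0 - B0)) - n * (A0 - Aa) - T * (B0 - Ba) - (c * y ^ (2 * m) + b * y) =
      (n * (Ax - Aa) - c * y ^ (2 * m)) + (T * (Bx - Ba) - b * y) +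
      n * ((Anx - An0) - (Ax - A0)) + T * ((Bnx - Bx) - (Bn0 - B0)) - n * (A0 - Aa) -
      T * (B0 - Ba) by ring]
    refine (abs_sub _ _).trans ((add_le_add ((abs_sub _ _).trans (add_le_add ((abs_add_le _ _).trans
      (add_le_add (abs_add_three _ _ _) le_rfl)) le_rfl)) le_rfl).trans ?_)
    linarith

/-- Upper bound for the exponent at a point far from the maximizers. -/
theorem exponent_le_of_far {n T C KA KB ε Aa A0 Anx An0 B0 Bnx Bn0 : ℝ}
    (hn1 : 1 ≤ n) (hT : 0 ≤ T) (hTn : T ^ 2 ≤ n) (hε : 0 < ε) (hC : 0 ≤ C) (hKB : 0 ≤ KB)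
    (fa : Anx ≤ Aa - ε) (fb : |Bnx| ≤ C) (na : |An0 - A0| ≤ C * Real.log n / n)
    (nb : |Bn0 - B0| ≤ C / n) (hB0 : |B0| ≤ KB) (hA0 : |n * (A0 - Aa)| ≤ KA)
    (hn : (2 * (4 * C + KB) / ε) ^ 2 ≤ n) :
    n * (Anx - An0) + T * (Bnx - Bn0) ≤ KA - ε / 2 * n := by
  have hn0 : 0 < n := by linarith
  have hsq0 : 0 ≤ Real.sqrt n := Real.sqrt_nonneg _
  have hsq : Real.sqrt n * Real.sqrt n = n := Real.mul_self_sqrt hn0.le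
  have hlog : Real.log n ≤ 2 * Real.sqrt n := by
    have := Real.log_le_sub_one_of_pos (Real.sqrt_pos.2 hn0)
    rw [Real.log_sqrt hn0.le] at this
    linarith
  have hlog' : C * Real.log n ≤ C * (2 * Real.sqrt n) := by gcongr
  have hTsq : T ≤ Real.sqrt n := Real.le_sqrt_of_sq_le hTn
  -- The errors total `(4 * C + KB) * √n`: `2 * C` comes from the logarithm and `2 * C + KB` from
  -- the term in `B_n`. For large `n` half of the gap `ε n` absorbs them.
  have hlast : (4 * C + KB) * Real.sqrt n ≤ ε / 2 * n := by
    have : 2 * (4 * C + KB) / ε ≤ Real.sqrt n := Real.le_sqrt_of_sq_le hn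
    rw [div_le_iff₀ hε] at this
    have := mul_le_mul_of_nonneg_right this hsq0
    rw [show Real.sqrt n * ε * Real.sqrt n = ε * (Real.sqrt n * Real.sqrt n) by ring, hsq] at this
    linarith
  have hA1 : n * (Anx - An0) ≤ -(ε * n) + KA + C * Real.log n := by
    have q1 : A0 - An0 ≤ C * Real.log n / n := by linarith [(abs_le.1 na).1]
    have q2 : n * (A0 - An0) ≤ C * Real.log n := by rwa [le_div_iff₀' hn0] at q1
    have q3 : n * Anx ≤ n * (Aa - ε) := by gcongr
    have q4 := (abs_le.1 hA0).1
    linarith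
  have hB1 : T * (Bnx - Bn0) ≤ Real.sqrt n * (2 * C + KB) := by
    have q1 : C / n ≤ C := div_le_self hC hn1
    have q2 := (abs_le.1 hB0).1
    have q3 := (abs_le.1 nb).1
    have q4 := (abs_le.1 fb).2
    calc _ ≤ T * (2 * C + KB) := by gcongr; linarith
      _ ≤ _ := by gcongr
  linarith

set_option maxHeartbeats 1000000 in
-- The disjunction is forced by the boundary. The window is closed, but `NearCondition` covers only
-- the open interval. At `|x - a j| = δ` no expansion is available; `FarCondition` makes the weight
-- tiny, and since `|y| = s δ` there, the error bound `K r (1 + |y|)` is at least `1` and hence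
-- trivial.
theorem exists_weight_bounds {J : Type*} {a : J → ℝ} {m : J → ℕ} (hm : ∀ j, 1 ≤ m j)
    {mStar : ℕ} {ε δ Cst : ℝ} (hε : 0 < ε) (hδ : 0 < δ) (hCst : 0 < Cst) {A B : ℝ → ℝ}
    (hA : ContDiffOn ℝ (2 * mStar + 1 : ℕ) A (Icc 0 1)) (hB : ContDiffOn ℝ 2 B (Icc 0 1))
    {An Bn : ℕ → ℝ → ℝ} (h1 : MaximizerCondition a m mStar δ A)
    (h2 : FarCondition a ε δ Cst A An Bn) (h3 : NearCondition a δ Cst A B An Bn) (j : J) :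
    ∃ κ K : ℝ, 0 < κ ∧ 0 ≤ K ∧ ∀ᶠ n : ℕ in atTop, ∃ k₀ ∈ gridWindow n (a j) δ,
      ∀ k ∈ gridWindow n (a j) δ, ∀ y u : ℝ, y = scale (m j) n * ((k : ℝ) / n - a j) →
        u = hamiltonian mStar An Bn n ((k : ℝ) / n) -
          hamiltonian mStar An Bn n ((k₀ : ℝ) / n) →
        u ≤ K - κ * y ^ (2 * m j) ∧
        (|u - (coeffC A (m j) (a j) * y ^ (2 * m j) + coeffB B (m j) mStar (a j) * y)| ≤
          K * rate (m j) mStar n * (1 + |y|) ^ (2 * m j + 1) ∨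
          1 ≤ K * rate (m j) mStar n * (1 + |y|)) := by
  have hmM : m j ≤ mStar := h1.isGreatest.2 (mem_range_self j)
  have hends := (Ioo_subset_Ioo_iff (by linarith)).1 (h1.subset j)
  have hsub : Icc (a j - δ) (a j + δ) ⊆ Icc 0 1 := Icc_subset_Icc hends.1 hends.2
  have ha : a j ∈ Icc (0 : ℝ) 1 := hsub ⟨by linarith, by linarith⟩
  obtain ⟨κ, KA, hκ, hKA, hTay⟩ := exists_bounds_of_flat_max (hm j)
    (hA.of_le (by norm_cast; omega)) hδ hsub (h1.deriv_eq_zero j) (h1.deriv_neg j)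
  obtain ⟨KB, hKB, hBb, hBl, hBt⟩ := exists_bounds_of_contDiffOn_two hB ha
  set c := coeffC A (m j) (a j) with hc
  set b := coeffB B (m j) mStar (a j) with hb
  set KA' := KA + |c| with hKA'
  have hmax : sSup (A '' Icc 0 1) = A (a j) := by
    have hmx := ((h1.maximizers (a j)).1 (mem_range_self j)).2
    refine IsGreatest.csSup_eq ⟨mem_image_of_mem A ha, ?_⟩
    rintro _ ⟨x, hx, rfl⟩
    exact hmx hx
  set L := 3 * Cst + 2 * KA' + 2 * KB with hL
  have hKA'0 : 0 ≤ KA' := by positivity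
  have hL0 : 0 ≤ L := by positivity
  -- At the boundary `y ^ (2 * m j) = n * δ ^ (2 * m j)`, so `η * y ^ (2 * m j)` is exactly the gain
  -- `ε / 2 * n` of the far estimate.
  set η := ε / (2 * δ ^ (2 * m j)) with hη
  have hη0 : 0 < η := by positivity
  -- The cost of absorbing `L * (1 + |y|)` into half of the decay `κ * y ^ (2 * m j)`.
  set K₁ := L + (κ / 2 + L ^ 2 / (4 * (κ / 2))) with hK₁
  have hK₁0 : 0 ≤ K₁ := by positivity
  refine ⟨min (κ / 2) η, K₁ + KA' + L + 1 / δ, lt_min (by positivity) hη0, by positivity, ?_⟩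
  set K := K₁ + KA' + L + 1 / δ with hK
  have hlarge : ∀ᶠ n : ℕ in atTop, (1 / δ < (n : ℝ)) ∧ (2 * (4 * Cst + KB) / ε) ^ 2 ≤ (n : ℝ) :=
    (tendsto_natCast_atTop_atTop.eventually_gt_atTop _).and
      (tendsto_natCast_atTop_atTop.eventually_ge_atTop _)
  filter_upwards [h2, h3, hlarge, eventually_ge_atTop 1] with n hfar hnear hn hn1
  have hn0 : (0 : ℝ) < n := by exact_mod_cast hn1
  have hnδ : 1 / (n : ℝ) < δ := by rw [div_lt_comm₀ hn0 hδ]; exact hn.1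
  set k₀ := ⌊(n : ℝ) * a j⌋₊ with hk₀
  have hna : 0 ≤ (n : ℝ) * a j := mul_nonneg hn0.le ha.1
  have hk₀a : (k₀ : ℝ) ≤ n * a j := Nat.floor_le hna
  have hk₀b : (n : ℝ) * a j < k₀ + 1 := Nat.lt_floor_add_one _
  have hk₀n : k₀ ≤ n := by
    have : (k₀ : ℝ) ≤ n := hk₀a.trans (mul_le_of_le_one_right hn0.le ha.2)
    exact_mod_cast this
  have hx₀ : |(k₀ : ℝ) / n - a j| ≤ 1 / n := by
    have : (k₀ : ℝ) / n - a j = (k₀ - n * a j) / n := by field_simp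
    rw [this, abs_div, abs_of_pos hn0]
    gcongr
    rw [abs_le]; constructor <;> linarith
  have habs : ∀ k : ℕ, |(k : ℝ) - n * a j| = n * |(k : ℝ) / n - a j| := fun k => by
    rw [← abs_of_pos hn0, ← abs_mul, abs_of_pos hn0]; congr 1; field_simp
  have hk₀w : k₀ ∈ gridWindow n (a j) δ := by
    rw [mem_gridWindow, habs]
    exact ⟨hk₀n, by gcongr; linarith⟩
  refine ⟨k₀, hk₀w, ?_⟩
  rintro k hk y u rfl rfl
  rw [mem_gridWindow, habs] at hk
  set s := scale (m j) n with hs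
  set T := scale mStar n with hT
  set r := rate (m j) mStar n with hr
  have hs1 : 1 ≤ s := one_le_scale _ hn1
  have hT1 : 1 ≤ T := one_le_scale _ hn1
  have hTs : T ≤ s := scale_anti (hm j) hmM hn1
  have hspow : s ^ (2 * m j) = n := scale_pow (hm j) n
  have hsn : s ^ 2 ≤ n := scale_sq_le (hm j) hn1
  have hsr : 1 / s ≤ r := inv_scale_le_rate _ _ hn1
  have hr0 : 0 < r := lt_of_lt_of_le (by positivity) hsr
  set x := (k : ℝ) / n with hx
  set x₀ := (k₀ : ℝ) / n with hx₀def
  have hxδ : |x - a j| ≤ δ := le_of_mul_le_mul_left hk.2 hn0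
  have hmem : ∀ z, |z - a j| ≤ δ → z ∈ Icc (0 : ℝ) 1 := fun z hz => by
    rw [abs_le] at hz; exact hsub ⟨by linarith, by linarith⟩
  have hu : hamiltonian mStar An Bn n x - hamiltonian mStar An Bn n x₀ =
      n * (An n x - An n x₀) + T * (Bn n x - Bn n x₀) := by
    rw [hamiltonian, hamiltonian, mul_sigma mStar hn1]; ring
  rw [hu]
  have hev : 0 ≤ (s * (x - a j)) ^ (2 * m j) := (even_two_mul _).pow_nonneg _
  have hx₀δ : |x₀ - a j| < δ := hx₀.trans_lt hnδ
  have hn1' : (1 : ℝ) ≤ n := by exact_mod_cast hn1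
  have hx₀1 : |x₀ - a j| ≤ 1 := hx₀.trans (by rw [div_le_one hn0]; exact hn1')
  have hA0 : |A x₀ - A (a j)| ≤ KA' * |x₀ - a j| ^ 2 := by
    have t := (hTay x₀ hx₀δ.le).2
    have t1 : |x₀ - a j| ^ (2 * m j + 1) ≤ |x₀ - a j| ^ 2 :=
      pow_le_pow_of_le_one (abs_nonneg _) hx₀1 (by have := hm j; omega)
    have t2 : |x₀ - a j| ^ (2 * m j) ≤ |x₀ - a j| ^ 2 :=
      pow_le_pow_of_le_one (abs_nonneg _) hx₀1 (by have := hm j; omega)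
    calc |A x₀ - A (a j)| = |(A x₀ - A (a j) - c * (x₀ - a j) ^ (2 * m j)) +
          c * (x₀ - a j) ^ (2 * m j)| := by ring_nf
      _ ≤ KA * |x₀ - a j| ^ (2 * m j + 1) + |c| * |x₀ - a j| ^ (2 * m j) := by
          refine (abs_add_le _ _).trans ?_
          rw [abs_mul, abs_pow]
          gcongr
      _ ≤ KA * |x₀ - a j| ^ 2 + |c| * |x₀ - a j| ^ 2 := by gcongr
      _ = _ := by rw [hKA']; ring
  have hK1K : K₁ ≤ K := by
    have : 0 < 1 / δ := by positivity
    linarith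
  rcases hxδ.lt_or_eq with hlt | heq
  · obtain ⟨-, nb, ninc⟩ := hnear k k₀ hk.1 hk₀n ⟨j, hlt, hx₀δ⟩
    obtain ⟨-, nb₀, -⟩ := hnear k₀ k hk₀n hk.1 ⟨j, hx₀δ, hlt⟩
    have hinc : |An n x - An n x₀ - (A x - A x₀)| ≤ Cst * |(x - a j) - (x₀ - a j)| / n := by
      refine ninc.trans_eq ?_
      have : (k : ℝ) - k₀ = n * ((x - a j) - (x₀ - a j)) := by
        rw [hx, hx₀def]; field_simp; ring
      rw [this, abs_mul, abs_of_pos hn0]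
      field_simp
    have hbT : |T * (B x - B (a j)) - b * (s * (x - a j))| ≤
        KB * r * (1 + |s * (x - a j)|) ^ 2 := by
      have hds : |x - a j| = |s * (x - a j)| / s := by
        rw [abs_mul, abs_of_pos (by linarith : 0 < s)]; field_simp
      have hy0 := abs_nonneg (s * (x - a j))
      -- If `m j = mStar` then `T = s` and the linear term of `B` survives as `b y`. Otherwise the
      -- whole increment of `B` is an error of order `T / s`, the second term of the rate.
      by_cases hmm : m j = mStar
      · have hTs' : T = s := by rw [hT, hs, hmm]
        have hbb : b = derivWithin B (Icc 0 1) (a j) := by rw [hb, coeffB, if_pos hmm]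
        have : T * (B x - B (a j)) - b * (s * (x - a j)) =
            s * (B x - B (a j) - derivWithin B (Icc 0 1) (a j) * (x - a j)) := by
          rw [hTs', hbb]; ring
        rw [this, abs_mul, abs_of_pos (by linarith : 0 < s)]
        calc _ ≤ s * (KB * |x - a j| ^ 2) := by gcongr; exact hBt x (hmem x hxδ)
          _ = KB * (1 / s) * |s * (x - a j)| ^ 2 := by rw [hds]; field_simp
          _ ≤ _ := by gcongr; linarith
      · have hbb : b = 0 := by rw [hb, coeffB, if_neg hmm]
        have hTr : T / s ≤ r := by
          rw [hr, rate_eq _ _ hn1, if_pos hmm]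
          have : 0 < 1 / s := by positivity
          linarith
        rw [hbb, zero_mul, sub_zero, abs_mul, abs_of_pos (by linarith : 0 < T)]
        calc _ ≤ T * (KB * |x - a j|) := by gcongr; exact hBl x (hmem x hxδ)
          _ = KB * (T / s) * |s * (x - a j)| := by rw [hds]; field_simp
          _ ≤ _ := by
              gcongr
              exact (by linarith : |s * (x - a j)| ≤ 1 + |s * (x - a j)|).trans
                (le_self_pow₀ (by linarith) two_ne_zero)
    have hAx := hTay x hxδ
    obtain ⟨g1, g2⟩ := abs_exponent_sub_le (hm j) hs1 hspow hsn hT1 hTs hsr hCst.le hKA'0 hKB hx₀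
      (hAx.2.trans (by gcongr; rw [hKA']; linarith [abs_nonneg c])) hAx.1 hA0 hinc nb nb₀
      (hBl x (hmem x hxδ)) (hBl x₀ (hmem x₀ hx₀δ.le)) hbT
    constructor
    · have g3 := mul_abs_le_mul_pow_add (β := L) (show 0 < κ / 2 by positivity) (hm j) (s * (x - a j))
      have g4 : min (κ / 2) η * (s * (x - a j)) ^ (2 * m j) ≤ κ / 2 * (s * (x - a j)) ^ (2 * m j) := by
        gcongr; exact min_le_left _ _
      have g5 : (3 * Cst + KA' + 2 * KB) * (1 + |s * (x - a j)|) ≤ L * (1 + |s * (x - a j)|) := by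
        gcongr; rw [hL]; linarith
      linarith
    · left
      refine g2.trans ?_
      gcongr
      have : 0 < 1 / δ := by positivity
      linarith
  · obtain ⟨na₀, nb₀, -⟩ := hnear k₀ k₀ hk₀n hk₀n ⟨j, hx₀δ, hx₀δ⟩
    -- Disjointness puts distinct maximizers at distance at least `2 δ`, as otherwise their midpoint
    -- would lie in both intervals. A boundary point of one interval is therefore far from every
    -- maximizer.
    have hfark : ∀ i, δ ≤ |x - a i| := by
      intro i
      rcases eq_or_ne i j with rfl | hij
      · exact heq.ge
      have hdis := h1.disjoint i j hij
      have hsep : 2 * δ ≤ |a i - a j| := by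
        by_contra hcon
        push Not at hcon
        rw [abs_lt] at hcon
        have hmid : (a i + a j) / 2 ∈ Ioo (a i - δ) (a i + δ) := ⟨by linarith, by linarith⟩
        exact Set.disjoint_left.1 hdis hmid ⟨by linarith, by linarith⟩
      have := abs_sub_le (a i) x (a j)
      rw [abs_sub_comm (a i) x] at this
      linarith
    obtain ⟨fa, fb⟩ := hfar k hk.1 hfark
    rw [hmax] at fa
    have e0 : |n * (A x₀ - A (a j))| ≤ KA' := by
      rw [abs_mul, abs_of_pos hn0]
      calc n * |A x₀ - A (a j)| ≤ n * (KA' * (1 / n) ^ 2) := by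
            gcongr
            exact hA0.trans (by gcongr)
        _ = KA' * (1 / n) := by field_simp
        _ ≤ KA' := mul_le_of_le_one_right hKA'0 (by rw [div_le_one hn0]; exact hn1')
    have hfin := exponent_le_of_far hn1' (by linarith) (scale_sq_le ((hm j).trans hmM) hn1) hε
      hCst.le hKB fa fb na₀ nb₀ (hBb x₀ (hmem x₀ hx₀δ.le)) e0 hn.2
    have hyp : (s * (x - a j)) ^ (2 * m j) = n * δ ^ (2 * m j) := by
      rw [mul_pow, hspow, ← (even_two_mul (m j)).pow_abs, heq]
    constructor
    · have g4 : min (κ / 2) η * (s * (x - a j)) ^ (2 * m j) ≤ η * (s * (x - a j)) ^ (2 * m j) := by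
        gcongr; exact min_le_right _ _
      have g5 : η * (s * (x - a j)) ^ (2 * m j) = ε / 2 * n := by
        rw [hyp, hη]; field_simp
      have g6 : KA' ≤ K := by
        have : 0 < 1 / δ := by positivity
        linarith
      linarith
    · right
      have q1 : |s * (x - a j)| = s * δ := by rw [abs_mul, abs_of_pos (by linarith : 0 < s), heq]
      rw [q1]
      calc (1 : ℝ) = 1 / δ * (1 / s) * (s * δ) := by field_simp
        _ ≤ K * r * (1 + s * δ) := by
          gcongr
          · linarith
          · linarith

/-! ### Convergence of the conditional averages -/

theorem exists_exp_mul_pow_le {m : ℕ} (hm : 1 ≤ m) {κ : ℝ} (hκ : 0 < κ) (K : ℝ) (l : ℕ) :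
    ∃ C : ℝ, 0 < C ∧ ∀ y u : ℝ, u ≤ K - κ * y ^ (2 * m) → (1 + |y|) ^ l * Real.exp u ≤ C := by
  obtain ⟨C, hC, h⟩ := one_add_abs_pow_mul_exp_le hκ hm l
  refine ⟨C * Real.exp K, by positivity, fun y u hu => ?_⟩
  have h1 : Real.exp u ≤ Real.exp (-κ * y ^ (2 * m)) * Real.exp K := by
    rw [← Real.exp_add]
    exact Real.exp_le_exp.2 (by linarith)
  calc _ ≤ (1 + |y|) ^ l * (Real.exp (-κ * y ^ (2 * m)) * Real.exp K) := by gcongr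
    _ = ((1 + |y|) ^ l * Real.exp (-κ * y ^ (2 * m))) * Real.exp K := by ring
    _ ≤ _ := by gcongr; exact h y

theorem exists_abs_exp_sub_tilt_le {m : ℕ} (hm : 1 ≤ m) {c : ℝ} (hc : c < 0) (b : ℝ) {κ K : ℝ}
    (hκ : 0 < κ) (hK : 0 ≤ K) :
    ∃ K₀ : ℝ, 0 ≤ K₀ ∧ ∀ r y u : ℝ, 0 ≤ r → u ≤ K - κ * y ^ (2 * m) →
      (|u - (c * y ^ (2 * m) + b * y)| ≤ K * r * (1 + |y|) ^ (2 * m + 1) ∨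
        1 ≤ K * r * (1 + |y|)) →
      |Real.exp u - tilt m c b y| * (1 + |y|) ^ 3 ≤ K₀ * r := by
  obtain ⟨C₁, hC₁, h₁⟩ := exists_exp_mul_pow_le hm hκ K (2 * m + 4)
  obtain ⟨C₂, hC₂, h₂⟩ := exists_pow_mul_tilt_le hm hc b (2 * m + 4)
  refine ⟨K * (C₁ + C₂), by positivity, fun r y u hr hu h => ?_⟩
  have ht := tilt_pos m c b y
  have hρ : 1 ≤ 1 + |y| := by linarith [abs_nonneg y]
  -- In the second alternative the factor in front is at least `1`, so the bound is just the
  -- triangle inequality.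
  have key : |Real.exp u - tilt m c b y| ≤
      K * r * (1 + |y|) ^ (2 * m + 1) * (Real.exp u + tilt m c b y) := by
    rcases h with h | h
    · refine (abs_exp_sub_exp_le _ _).trans ?_
      change _ * (Real.exp u + tilt m c b y) ≤ _
      gcongr
    · have h3 : |Real.exp u - tilt m c b y| ≤ Real.exp u + tilt m c b y := by
        refine (abs_sub _ _).trans_eq ?_
        rw [abs_of_pos (Real.exp_pos u), abs_of_pos ht]
      refine h3.trans (le_mul_of_one_le_left (by positivity) (h.trans ?_))
      gcongr
      exact le_self_pow₀ hρ (by omega)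
  calc _ ≤ K * r * (1 + |y|) ^ (2 * m + 1) * (Real.exp u + tilt m c b y) * (1 + |y|) ^ 3 := by
        gcongr
    _ = K * r * ((1 + |y|) ^ (2 * m + 4) * Real.exp u +
          (1 + |y|) ^ (2 * m + 4) * tilt m c b y) := by ring
    _ ≤ K * r * (C₁ + C₂) := by gcongr; exacts [h₁ y u hu, h₂ y]
    _ = _ := by ring

theorem abs_div_sub_div_le {N D N' D' e M : ℝ} (hD : 0 < D) (hD' : D / 2 ≤ D')
    (hN : |N' - N| ≤ e) (hDe : |D' - D| ≤ e) (hM : |N| ≤ M) :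
    |N' / D' - N / D| ≤ 2 * (D + M) / D ^ 2 * e := by
  have hD'0 : 0 < D' := by linarith
  have he : 0 ≤ e := (abs_nonneg _).trans hN
  have hM0 : 0 ≤ M := (abs_nonneg _).trans hM
  have h1 : N' / D' - N / D = ((N' - N) * D - N * (D' - D)) / (D' * D) := by field_simp; ring
  rw [h1, abs_div, abs_of_pos (mul_pos hD'0 hD)]
  have h2 : |(N' - N) * D - N * (D' - D)| ≤ e * D + M * e := by
    refine (abs_sub _ _).trans ?_
    rw [abs_mul, abs_mul, abs_of_pos hD]
    gcongr
  calc _ ≤ (e * D + M * e) / (D / 2 * D) := by gcongr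
    _ = _ := by field_simp

theorem tendsto_rate {m M : ℕ} (hm : 1 ≤ m) (hmM : m ≤ M) :
    Tendsto (fun n : ℕ => rate m M n) atTop (nhds 0) := by
  have hm0 : (0 : ℝ) < m := by exact_mod_cast hm
  have h1 : Tendsto (fun n : ℕ => (n : ℝ) ^ (-1 / (2 * (m : ℝ)))) atTop (nhds 0) := by
    have := (tendsto_rpow_neg_atTop (y := 1 / (2 * (m : ℝ))) (by positivity)).comp
      tendsto_natCast_atTop_atTop
    exact this.congr fun n => by rw [neg_div]; rfl
  unfold rate
  split_ifs with h
  · have hlt : (m : ℝ) < M := by exact_mod_cast lt_of_le_of_ne hmM h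
    have hpos : 0 < 1 / (2 * (m : ℝ)) - 1 / (2 * (M : ℝ)) := by
      rw [sub_pos]
      exact one_div_lt_one_div_of_lt (by positivity) (by linarith)
    have := (tendsto_rpow_neg_atTop hpos).comp tendsto_natCast_atTop_atTop
    simp only [neg_sub] at this
    simpa using h1.add this
  · simpa using h1

/-! ### Asymptotics of averages over the window -/

section Model

variable {J : Type*} {a : J → ℝ} {m : J → ℕ} {mStar : ℕ} {ε δ Cst : ℝ} {A B : ℝ → ℝ}
  {An Bn : ℕ → ℝ → ℝ}

theorem MaximizerCondition.Icc_subset (h1 : MaximizerCondition a m mStar δ A) (hδ : 0 < δ)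
    (j : J) : Icc (a j - δ) (a j + δ) ⊆ Icc 0 1 :=
  have h := (Ioo_subset_Ioo_iff (by linarith)).1 (h1.subset j)
  Icc_subset_Icc h.1 h.2

theorem MaximizerCondition.coeffC_neg (h1 : MaximizerCondition a m mStar δ A) (hδ : 0 < δ)
    (j : J) : coeffC A (m j) (a j) < 0 :=
  div_neg_of_neg_of_pos (h1.deriv_neg j _ (by simpa using hδ.le))
    (by exact_mod_cast Nat.factorial_pos _)

/-- The average of `ψ` under the Gibbs law conditioned on the window. -/
noncomputable def windowAverage (M : ℕ) (An Bn : ℕ → ℝ → ℝ) (n : ℕ) (a δ : ℝ) (ψ : ℕ → ℝ) : ℝ :=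
  (∑ k ∈ gridWindow n a δ, ψ k * Real.exp (hamiltonian M An Bn n ((k : ℝ) / n))) /
    ∑ k ∈ gridWindow n a δ, Real.exp (hamiltonian M An Bn n ((k : ℝ) / n))

/-- With `τ` the mesh and `E` the exponent at the base point, numerator and denominator become
Riemann sums with finite limits. -/
theorem windowAverage_eq (M : ℕ) (An Bn : ℕ → ℝ → ℝ) (n : ℕ) (a δ : ℝ) (ψ : ℕ → ℝ) {τ : ℝ}
    (hτ : τ ≠ 0) (E : ℝ) :
    windowAverage M An Bn n a δ ψ =
      (τ * ∑ k ∈ gridWindow n a δ, ψ k * Real.exp (hamiltonian M An Bn n ((k : ℝ) / n) - E)) /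
        (τ * ∑ k ∈ gridWindow n a δ, Real.exp (hamiltonian M An Bn n ((k : ℝ) / n) - E)) := by
  rw [mul_div_mul_left _ _ hτ, windowAverage]
  simp only [Real.exp_sub, mul_div_assoc']
  rw [← Finset.sum_div, ← Finset.sum_div, div_div_div_cancel_right₀ (Real.exp_pos E).ne']

theorem windowAverage_mono (M : ℕ) (An Bn : ℕ → ℝ → ℝ) (n : ℕ) (a δ : ℝ) {ψ : ℕ → ℝ} {C : ℝ}
    (hC : 0 ≤ C) (h : ∀ k ∈ gridWindow n a δ, ψ k ≤ C) : windowAverage M An Bn n a δ ψ ≤ C := by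
  refine div_le_of_le_mul₀ (Finset.sum_nonneg fun _ _ => (Real.exp_pos _).le) hC ?_
  rw [Finset.mul_sum]
  exact Finset.sum_le_sum fun k hk => mul_le_mul_of_nonneg_right (h k hk) (Real.exp_pos _).le

theorem windowAverage_neg (M : ℕ) (An Bn : ℕ → ℝ → ℝ) (n : ℕ) (a δ : ℝ) (ψ : ℕ → ℝ) :
    windowAverage M An Bn n a δ (fun k => -ψ k) = -windowAverage M An Bn n a δ ψ := by
  simp [windowAverage, neg_div]

theorem eventually_windowAverage (hm : ∀ j, 1 ≤ m j)
    (hε : 0 < ε) (hδ : 0 < δ) (hCst : 0 < Cst)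
    (hA : ContDiffOn ℝ (2 * mStar + 1 : ℕ) A (Icc 0 1)) (hB : ContDiffOn ℝ 2 B (Icc 0 1))
    (h1 : MaximizerCondition a m mStar δ A)
    (h2 : FarCondition a ε δ Cst A An Bn) (h3 : NearCondition a δ Cst A B An Bn) (j : J) :
    (∀ᶠ n : ℕ in atTop, (gridWindow n (a j) δ).Nonempty) ∧
    (∀ l : ℕ, ∃ C : ℝ, 0 < C ∧ ∀ᶠ n : ℕ in atTop,
      windowAverage mStar An Bn n (a j) δ (fun k => |(k : ℝ) / n - a j| ^ l) ≤
        C * (scale (m j) n ^ l)⁻¹) ∧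
    ∃ C : ℝ, 0 < C ∧ ∀ᶠ n : ℕ in atTop, ∀ φ : ℝ → ℝ, (∀ x y, |φ x - φ y| ≤ |x - y|) →
      (∀ x, |φ x| ≤ 1 + |x|) →
      |windowAverage mStar An Bn n (a j) δ (fun k => φ (scale (m j) n * ((k : ℝ) / n - a j))) -
        (∫ y, φ y * tilt (m j) (coeffC A (m j) (a j)) (coeffB B (m j) mStar (a j)) y) /
          ∫ y, tilt (m j) (coeffC A (m j) (a j)) (coeffB B (m j) mStar (a j)) y| ≤
        C * rate (m j) mStar n := by
  obtain ⟨κ, K, hκ, hK, hev⟩ := exists_weight_bounds hm hε hδ hCst hA hB h1 h2 h3 j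
  have hmM : m j ≤ mStar := h1.isGreatest.2 (mem_range_self j)
  have hc := h1.coeffC_neg hδ j
  have hsub := h1.Icc_subset hδ j
  set c := coeffC A (m j) (a j)
  set b := coeffB B (m j) mStar (a j)
  obtain ⟨K₀, hK₀, hw⟩ := exists_abs_exp_sub_tilt_le (hm j) hc b hκ hK
  obtain ⟨C, hC, hsum⟩ := exists_abs_sum_sub_integral_le (hm j) hc b hK₀ hδ hsub
  have hD := integral_tilt_pos (hm j) hc b
  set D := ∫ y, tilt (m j) c b y with hDdef
  -- Keeps the normalised denominator above `D / 2`.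
  have hsmall : ∀ᶠ n : ℕ in atTop, rate (m j) mStar n < D / (2 * C) :=
    (tendsto_rate (hm j) hmM).eventually_lt_const (by positivity)
  have hcore : ∀ᶠ n : ℕ in atTop, 1 ≤ n ∧ ∃ E : ℝ, ∀ W : ℕ → ℝ,
      W = (fun k : ℕ => Real.exp (hamiltonian mStar An Bn n ((k : ℝ) / n) - E)) →
      (∀ k ∈ gridWindow n (a j) δ, ∃ u, W k = Real.exp u ∧
        u ≤ K - κ * (scale (m j) n * ((k : ℝ) / n - a j)) ^ (2 * m j)) ∧
      (∀ φ : ℝ → ℝ, (∀ x y, |φ x - φ y| ≤ |x - y|) → (∀ x, |φ x| ≤ 1 + |x|) →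
        |scale (m j) n / n * ∑ k ∈ gridWindow n (a j) δ,
          φ (scale (m j) n * ((k : ℝ) / n - a j)) * W k - ∫ y, φ y * tilt (m j) c b y| ≤
          C * rate (m j) mStar n) ∧
      |scale (m j) n / n * ∑ k ∈ gridWindow n (a j) δ, W k - D| ≤ C * rate (m j) mStar n ∧
      D / 2 ≤ scale (m j) n / n * ∑ k ∈ gridWindow n (a j) δ, W k := by
    filter_upwards [hev, hsmall, eventually_ge_atTop 1] with n hn hsm hn1
    obtain ⟨k₀, -, hk⟩ := hn
    refine ⟨hn1, hamiltonian mStar An Bn n ((k₀ : ℝ) / n), ?_⟩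
    rintro W rfl
    have hs1 := one_le_scale (m j) hn1
    have hr := inv_scale_le_rate (m j) mStar hn1
    have hr0 : 0 ≤ rate (m j) mStar n := le_trans (by positivity) hr
    have hφ := fun φ => hsum n (scale (m j) n) (rate (m j) mStar n)
      (fun k => Real.exp (hamiltonian mStar An Bn n ((k : ℝ) / n) -
        hamiltonian mStar An Bn n ((k₀ : ℝ) / n))) φ hn1 hs1 (scale_sq_le (hm j) hn1) hr
      (fun k hkm => hw _ _ _ hr0 (hk k hkm _ _ rfl rfl).1 (hk k hkm _ _ rfl rfl).2)
    -- The constant `1` is an admissible test function; it gives the denominator.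
    have hone := hφ (fun _ => 1) (fun x y => by simp) (fun x => by simp)
    simp only [one_mul] at hone
    refine ⟨fun k hkm => ⟨_, rfl, (hk k hkm _ _ rfl rfl).1⟩, hφ, hone, ?_⟩
    rw [lt_div_iff₀ (by positivity)] at hsm
    have := (abs_le.1 hone).1
    linarith
  refine ⟨?_, fun l => ?_, ?_⟩
  · filter_upwards [hev] with n ⟨k₀, hk₀, _⟩
    exact ⟨k₀, hk₀⟩
  -- Of the `l + 2` powers, `l` serve the moment and two make the sum converge.
  · obtain ⟨C', hC', hdec⟩ := exists_exp_mul_pow_le (hm j) hκ K (l + 2)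
    refine ⟨C' * 4 * Real.pi / (D / 2), by positivity, ?_⟩
    filter_upwards [hcore] with n ⟨hn1, E, hE⟩
    obtain ⟨hW, -, -, hD2⟩ := hE _ rfl
    have hs1 := one_le_scale (m j) hn1
    have hn0 : (0 : ℝ) < n := by exact_mod_cast hn1
    have hsn : scale (m j) n ≤ n :=
      (le_self_pow₀ hs1 two_ne_zero).trans (scale_sq_le (hm j) hn1)
    rw [windowAverage_eq mStar An Bn n (a j) δ _ (τ := scale (m j) n / n) (by positivity) E]
    have hpull : ∀ k : ℕ, |(k : ℝ) / n - a j| ^ l =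
        (scale (m j) n ^ l)⁻¹ * |scale (m j) n * ((k : ℝ) / n - a j)| ^ l := fun k => by
      rw [abs_mul, mul_pow, abs_of_pos (by linarith : 0 < scale (m j) n)]
      field_simp
    have hbd := abs_sum_le_of_decay hs1 hsn hC'.le (a := a j) (δ := δ)
      (fun k => |scale (m j) n * ((k : ℝ) / n - a j)| ^ l *
        Real.exp (hamiltonian mStar An Bn n ((k : ℝ) / n) - E)) (fun k hk => by
        obtain ⟨u, hu, hu'⟩ := hW k hk
        change Real.exp _ = _ at hu
        rw [abs_of_nonneg (by positivity), hu]
        refine le_trans ?_ (hdec _ u hu')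
        rw [pow_add, mul_right_comm]
        gcongr
        linarith)
    simp only [hpull, mul_assoc ((scale (m j) n ^ l)⁻¹)]
    rw [← Finset.mul_sum, mul_left_comm, mul_comm _ ((scale (m j) n ^ l)⁻¹), mul_div_assoc]
    refine mul_le_mul_of_nonneg_left ?_ (by positivity)
    exact div_le_div₀ (by positivity) ((le_abs_self _).trans hbd) (by positivity) hD2
  · refine ⟨2 * (D + ∫ y, (1 + |y|) * tilt (m j) c b y) / D ^ 2 * C, ?_, ?_⟩
    · have : 0 ≤ ∫ y, (1 + |y|) * tilt (m j) c b y :=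
        integral_nonneg fun y => mul_nonneg (by positivity) (tilt_pos _ _ _ _).le
      positivity
    filter_upwards [hcore] with n ⟨hn1, E, hE⟩ φ hφL hφ
    obtain ⟨-, hφs, hDe, hD2⟩ := hE _ rfl
    have hs1 := one_le_scale (m j) hn1
    have hn0 : (0 : ℝ) < n := by exact_mod_cast hn1
    rw [windowAverage_eq mStar An Bn n (a j) δ _ (τ := scale (m j) n / n) (by positivity) E,
      mul_assoc _ C]
    refine abs_div_sub_div_le hD hD2 (hφs φ hφL hφ) hDe ?_
    rw [← Real.norm_eq_abs]
    refine norm_integral_le_of_norm_le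
      (integrable_mul_tilt (hm j) hc b (by fun_prop) fun x => ?_) (ae_of_all _ fun y => ?_)
    · exact (abs_of_nonneg (by positivity)).le
    · rw [Real.norm_eq_abs, abs_mul, abs_of_pos (tilt_pos _ _ _ _)]
      exact mul_le_mul_of_nonneg_right (hφ y) (tilt_pos _ _ _ _).le

end Model

/-! ### From averages to the Wasserstein distance -/

/-- Both laws have mass one, so `h` may be replaced by `h - h 0`, whose growth is bounded by `|x|`
uniformly in `h`. -/
theorem HasGibbsLaw.integral_cond_map_sub {Ω : Type*} [MeasurableSpace Ω] {P : Measure Ω}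
    [IsProbabilityMeasure P] {X : Ω → ℕ} {M n : ℕ} {An Bn : ℕ → ℝ → ℝ} (hX : Measurable X)
    (hlaw : HasGibbsLaw P X M An Bn n) {a δ : ℝ} (hP : P (window X n a δ) ≠ 0) {m : ℕ}
    (hm : 1 ≤ m) {c : ℝ} (hc : c < 0) (b s : ℝ) {h : ℝ → ℝ} (hh : LipschitzWith 1 h) :
    ∫ x, h x ∂((ProbabilityTheory.cond P (window X n a δ)).map
        fun ω => s * ((X ω : ℝ) / n - a)) - ∫ x, h x ∂(limitLaw m c b) =
      windowAverage M An Bn n a δ (fun k => h (s * ((k : ℝ) / n - a)) - h 0) -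
        (∫ y, (h y - h 0) * tilt m c b y) / ∫ y, tilt m c b y := by
  have hprob : IsProbabilityMeasure (ProbabilityTheory.cond P (window X n a δ)) :=
    cond_isProbabilityMeasure hP
  have hD := integral_tilt_pos hm hc b
  have hne : ∑ k ∈ gridWindow n a δ, Real.exp (hamiltonian M An Bn n ((k : ℝ) / n)) ≠ 0 := by
    intro h0
    have := hlaw.integral_cond hX a δ fun _ => 1
    rw [h0] at this
    simp at this
  have hφ : ∀ x y, |(h x - h 0) - (h y - h 0)| ≤ |x - y| := fun x y => by
    simpa [Real.dist_eq] using hh.dist_le_mul x y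
  have hint := integrable_mul_tilt hm hc b (φ := fun y => h y - h 0)
    (hh.continuous.sub continuous_const) fun x => by
      have := hφ x 0
      simp only [sub_self, sub_zero] at this
      linarith
  have hmeas : Measurable fun ω => s * ((X ω : ℝ) / n - a) :=
    (((measurable_from_nat (f := fun k : ℕ => (k : ℝ))).comp hX).div_const _
      |>.sub_const a).const_mul s
  rw [integral_map hmeas.aemeasurable hh.continuous.aestronglyMeasurable,
    hlaw.integral_cond hX a δ fun k => h (s * ((k : ℝ) / n - a)), integral_limitLaw hm hc b]
  have e1 : windowAverage M An Bn n a δ (fun k => h (s * ((k : ℝ) / n - a)) - h 0) =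
      (∑ k ∈ gridWindow n a δ, h (s * ((k : ℝ) / n - a)) *
        Real.exp (hamiltonian M An Bn n ((k : ℝ) / n))) /
        ∑ k ∈ gridWindow n a δ, Real.exp (hamiltonian M An Bn n ((k : ℝ) / n)) - h 0 := by
    rw [windowAverage]
    simp only [sub_mul]
    rw [Finset.sum_sub_distrib, ← Finset.mul_sum, sub_div, mul_div_cancel_right₀ _ hne]
  have e2 : (∫ y, h y * tilt m c b y) =
      (∫ y, (h y - h 0) * tilt m c b y) + h 0 * ∫ y, tilt m c b y := by
    rw [← integral_const_mul, ← integral_add hint ((integrable_tilt hm hc b).const_mul _)]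
    congr 1
    ext y
    ring
  rw [e1, e2, add_div, mul_div_cancel_right₀ _ hD.ne']
  ring

end PerturbedModel

theorem mainTheorem1
    {J : Type*} [Finite J] (a : J → ℝ) (m : J → ℕ) (hm : ∀ j, 1 ≤ m j)
    (mStar : ℕ) (ε δ Cst : ℝ) (hε : 0 < ε) (hδ : 0 < δ) (hCst : 0 < Cst)
    (A B : ℝ → ℝ)
    (hA : ContDiffOn ℝ ((2 * mStar + 1 : ℕ) : WithTop ℕ∞) A (Icc 0 1))
    (hB : ContDiffOn ℝ 2 B (Icc 0 1))
    (An Bn : ℕ → ℝ → ℝ)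
    (h1 : PerturbedModel.MaximizerCondition a m mStar δ A)
    (h2 : PerturbedModel.FarCondition a ε δ Cst A An Bn)
    (h3 : PerturbedModel.NearCondition a δ Cst A B An Bn)
    {Ω : ℕ → Type*} [∀ n, MeasurableSpace (Ω n)]
    (P : ∀ n, Measure (Ω n)) [∀ n, IsProbabilityMeasure (P n)]
    (X : ∀ n, Ω n → ℕ) (hX : ∀ n, Measurable (X n))
    (hlaw : ∀ n, 1 ≤ n → PerturbedModel.HasGibbsLaw (P n) (X n) mStar An Bn n) :
    ∀ j : J,
      (∀ᶠ n : ℕ in atTop, P n (PerturbedModel.window (X n) n (a j) δ) ≠ 0) ∧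
      (∀ l : ℕ, ∃ C : ℝ, 0 < C ∧ ∀ n : ℕ, 1 ≤ n →
        P n (PerturbedModel.window (X n) n (a j) δ) ≠ 0 →
        ∫ ω, |(X n ω : ℝ) / n - a j| ^ l
            ∂(ProbabilityTheory.cond (P n) (PerturbedModel.window (X n) n (a j) δ))
          ≤ C * (n : ℝ) ^ (-(l : ℝ) / (2 * (m j : ℝ)))) ∧
      (∃ C : ℝ, 0 < C ∧ ∀ n : ℕ, 1 ≤ n →
        P n (PerturbedModel.window (X n) n (a j) δ) ≠ 0 →
        PerturbedModel.wasserstein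
            ((ProbabilityTheory.cond (P n) (PerturbedModel.window (X n) n (a j) δ)).map
              (fun ω => (n : ℝ) ^ (1 / (2 * (m j : ℝ))) * ((X n ω : ℝ) / n - a j)))
            (PerturbedModel.limitLaw (m j) (PerturbedModel.coeffC A (m j) (a j))
              (PerturbedModel.coeffB B (m j) mStar (a j)))
          ≤ ENNReal.ofReal (C * ((n : ℝ) ^ (-1 / (2 * (m j : ℝ))) +
              if m j ≠ mStar then
                (n : ℝ) ^ (1 / (2 * (mStar : ℝ)) - 1 / (2 * (m j : ℝ)))
              else 0))) := by
  intro j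
  obtain ⟨hne, hmom, C, hC, hW⟩ :=
    PerturbedModel.eventually_windowAverage hm hε hδ hCst hA hB h1 h2 h3 j
  have hgrid : ∀ n : ℕ, 1 ≤ n → ∀ k ∈ PerturbedModel.gridWindow n (a j) δ,
      |(k : ℝ) / n - a j| ≤ δ := fun n hn k hk => by
    have hn0 : (0 : ℝ) < n := by exact_mod_cast hn
    have h := (PerturbedModel.mem_gridWindow.1 hk).2
    have e : (k : ℝ) / n - a j = (k - n * a j) / n := by field_simp
    rw [e, abs_div, abs_of_pos hn0, div_le_iff₀ hn0]
    linarith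
  have hscale : ∀ n : ℕ, 1 ≤ n → PerturbedModel.scale (m j) n ≤ n := fun n hn =>
    (le_self_pow₀ (PerturbedModel.one_le_scale _ hn) two_ne_zero).trans
      (PerturbedModel.scale_sq_le (hm j) hn)
  refine ⟨?_, fun l => ?_, ?_⟩
  · filter_upwards [hne, eventually_ge_atTop 1] with n ⟨k, hk⟩ hn
    exact (hlaw n hn).window_ne_zero hk
  · obtain ⟨C', hC', hev⟩ := hmom l
    obtain ⟨N, hN⟩ := eventually_atTop.1 hev
    -- The second summand serves `n ≤ N`, where the deviation is at most `δ` and the scale at most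
    -- `N`.
    refine ⟨C' + δ ^ l * (N : ℝ) ^ l, by positivity, fun n hn _ => ?_⟩
    rw [(hlaw n hn).integral_cond (hX n) (a j) δ fun k => |(k : ℝ) / n - a j| ^ l,
      PerturbedModel.rpow_neg_div_eq]
    change PerturbedModel.windowAverage _ _ _ _ _ _ _ ≤ _
    have hs := PerturbedModel.one_le_scale (m j) hn
    rcases le_total N n with hNn | hNn
    · refine (hN n hNn).trans ?_
      gcongr
      exact le_add_of_nonneg_right (by positivity)
    · have hs' : PerturbedModel.scale (m j) n ^ l ≤ (N : ℝ) ^ l := by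
        gcongr
        exact (hscale n hn).trans (by exact_mod_cast hNn)
      refine (PerturbedModel.windowAverage_mono mStar An Bn n (a j) δ (C := δ ^ l) (by positivity)
        fun k hk => by gcongr; exact hgrid n hn k hk).trans ?_
      rw [← div_eq_mul_inv, le_div_iff₀ (by positivity)]
      calc _ ≤ δ ^ l * (N : ℝ) ^ l := by gcongr
        _ ≤ _ := le_add_of_nonneg_left hC'.le
  · have hc := h1.coeffC_neg hδ j
    obtain ⟨N, hN⟩ := eventually_atTop.1 hW
    set c := PerturbedModel.coeffC A (m j) (a j)
    set b := PerturbedModel.coeffB B (m j) mStar (a j)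
    have hD := PerturbedModel.integral_tilt_pos (hm j) hc b
    set D := ∫ y, PerturbedModel.tilt (m j) c b y
    set M₁ := ∫ y, (1 + |y|) * PerturbedModel.tilt (m j) c b y with hM₁
    have hM₁0 : 0 ≤ M₁ := integral_nonneg fun y =>
      mul_nonneg (by positivity) (PerturbedModel.tilt_pos _ _ _ _).le
    -- For `n ≤ N` the two averages are at most `N * δ` and `M₁ / D` in absolute value, and the rate
    -- is at least `1 / N`; this explains the second summand.
    refine ⟨C + (N * δ + M₁ / D) * N, by positivity, fun n hn hP => ?_⟩
    refine iSup₂_le fun h hh => ENNReal.ofReal_le_ofReal ?_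
    change |∫ x, h x ∂((ProbabilityTheory.cond (P n)
      (PerturbedModel.window (X n) n (a j) δ)).map
        fun ω => PerturbedModel.scale (m j) n * ((X n ω : ℝ) / n - a j)) - _| ≤
      _ * PerturbedModel.rate (m j) mStar n
    rw [(hlaw n hn).integral_cond_map_sub (hX n) hP (hm j) hc b _ hh]
    have hφL : ∀ x y, |(h x - h 0) - (h y - h 0)| ≤ |x - y| := fun x y => by
      simpa [Real.dist_eq] using hh.dist_le_mul x y
    have hφ : ∀ x, |h x - h 0| ≤ |x| := fun x => by simpa using hφL x 0
    have hr := PerturbedModel.inv_scale_le_rate (m j) mStar hn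
    have hs := PerturbedModel.one_le_scale (m j) hn
    have hr0 : 0 < PerturbedModel.rate (m j) mStar n := lt_of_lt_of_le (by positivity) hr
    rcases le_total N n with hNn | hNn
    · refine (hN n hNn (fun x => h x - h 0) hφL fun x => (hφ x).trans (by linarith)).trans ?_
      gcongr
      exact le_add_of_nonneg_right (by positivity)
    · have hnN : (n : ℝ) ≤ N := by exact_mod_cast hNn
      have hsN := (hscale n hn).trans hnN
      have hbd : ∀ k ∈ PerturbedModel.gridWindow n (a j) δ,
          |h (PerturbedModel.scale (m j) n * ((k : ℝ) / n - a j)) - h 0| ≤ N * δ := fun k hk => by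
        refine (hφ _).trans ?_
        rw [abs_mul, abs_of_pos (by linarith : 0 < PerturbedModel.scale (m j) n)]
        gcongr
        exact hgrid n hn k hk
      have b1 : |PerturbedModel.windowAverage mStar An Bn n (a j) δ (fun k =>
          h (PerturbedModel.scale (m j) n * ((k : ℝ) / n - a j)) - h 0)| ≤ N * δ := by
        refine abs_le'.2 ⟨PerturbedModel.windowAverage_mono _ _ _ _ _ _ (by positivity)
          fun k hk => (le_abs_self _).trans (hbd k hk), ?_⟩
        rw [← PerturbedModel.windowAverage_neg]
        exact PerturbedModel.windowAverage_mono _ _ _ _ _ _ (by positivity)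
          fun k hk => (neg_le_abs _).trans (hbd k hk)
      have b2 : |(∫ y, (h y - h 0) * PerturbedModel.tilt (m j) c b y) / D| ≤ M₁ / D := by
        rw [abs_div, abs_of_pos hD, ← Real.norm_eq_abs]
        gcongr
        refine norm_integral_le_of_norm_le
          (PerturbedModel.integrable_mul_tilt (hm j) hc b (by fun_prop) fun x =>
            (abs_of_nonneg (by positivity)).le) (ae_of_all _ fun y => ?_)
        rw [Real.norm_eq_abs, abs_mul, abs_of_pos (PerturbedModel.tilt_pos _ _ _ _)]
        exact mul_le_mul_of_nonneg_right ((hφ y).trans (by linarith))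
          (PerturbedModel.tilt_pos _ _ _ _).le
      have b3 : 1 ≤ N * PerturbedModel.rate (m j) mStar n := by
        calc (1 : ℝ) = PerturbedModel.scale (m j) n * (1 / PerturbedModel.scale (m j) n) := by
              field_simp
          _ ≤ _ := by gcongr
      calc _ ≤ N * δ + M₁ / D := (abs_sub _ _).trans (add_le_add b1 b2)
        _ ≤ (N * δ + M₁ / D) * (N * PerturbedModel.rate (m j) mStar n) :=
            le_mul_of_one_le_right (by positivity) b3
        _ ≤ _ := by
            rw [← mul_assoc]
            gcongr
            exact le_add_of_nonneg_left hC.le
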